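/- Notation. Let $x_1,x_2,\dots$ be commuting and $\theta_1,\theta_2,\dots$ anticommuting variables ($\theta_i\theta_j=-\theta_j\theta_i$, $\theta_i^2=0$, $x_i\theta_j=\theta_jx_i$). For $N\ge 0$, $\mathbb Z[x_1,\dots,x_N,\theta_1,\dots,\theta_N]^{S_N}$ is the ring of superpolynomials invariant under the diagonal action $\mathcal K_\sigma:\ x_i\mapsto x_{\sigma(i)},\ \theta_i\mapsto\theta_{\sigma(i)}$ of $S_N$. Let $\mathscr P^{S_\infty}_{(n|m)}(\mathbb Z)$ be the $\mathbb Z$-module of symmetric superfunctions in infinitely many variables that are homogeneous of degree $n$ in $x$ and $m$ in $\theta$ (the inverse limit over $N$, under $x_{N+1}=\theta_{N+1}=0$, of the symmetric superpolynomials of degree $(n|m)$ in $N$ pairs of variables). A superpartition $\Lambda=(\Lambda^a;\Lambda^s)=(\Lambda_1,\dots,\Lambda_m;\Lambda_{m+1},\Lambda_{m+2},\dots)$ of $(n|m)$, written $\Lambda\vdash(n|m)$, consists of integers $\Lambda_1>\dots>\Lambda_m\ge 0$ and $\Lambda_{m+1}\ge\Lambda_{m+2}\ge\dots\ge 0$ (eventually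 zero; trailing zeros are immaterial) with $\sum_i\Lambda_i=n$; $\Lambda^*$ is the partition obtained by reordering all its parts. Its conjugate $\Lambda'\vdash(n|m)$ has antisymmetric part $\{\operatorname{Card}\{k:\Lambda_k>b\}: b\in\Lambda^a\}$, arranged decreasingly, and its symmetric part is what remains of the conjugate partition $(\Lambda^*)'$ after these numbers are removed (this is transposition of the diagram of $\Lambda^*$ in which the topmost row of each length $b\in\Lambda^a$ carries a circle at its end). Bruhat order: for a composition $\lambda$ let $\lambda^+$ be its non-increasing rearrangement and $w_\lambda$ the permutation of minimal length with $\lambda=w_\lambda\lambda^+$. Then $\lambda\ge\mu$ if either $\lambda^+>\mu^+$ in dominance order, or $\lambda^+=\mu^+$ and $w_\lambda\le w_\mu$ in the Bruhat order of the symmetric group (a reduced word of $w_\lambda$ is a subword of a reduced word of $w_\mu$). Superpartitions of $(n|m)$ are compared through the compositions obtained by replacing the semicolon by a comma. The supermonomial $m_\Lambda$ is the sum of the distinct terms among $\mathcal K_\sigma(\theta_1\cdots\theta_m\,x_1^{\Lambda_1}x_2^{\Lambda_2}\cdots)$, $\sigma$ a permutation of the variables (in $N$ pairs of variables it is $0$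 if $N$ is less than $m$ plus the number of positive parts of $\Lambda^s$). The elementary superfunctions are $$e_k=\sum_{\#J=k}\ \prod_{j\in J}x_j,\qquad \tilde e_k=\sum_i\ \sum_{\#J=k,\ i\notin J}\theta_i\prod_{j\in J}x_j\qquad(k\ge 0),$$ so that $e_0=1$ and $\tilde e_0=\sum_i\theta_i$, and $e_\Lambda=\tilde e_{\Lambda_1}\cdots\tilde e_{\Lambda_m}\,e_{\Lambda_{m+1}}e_{\Lambda_{m+2}}\cdots$; let $\overleftarrow{e_\Lambda}=\tilde e_{\Lambda_m}\cdots\tilde e_{\Lambda_1}\,e_{\Lambda_{m+1}}e_{\Lambda_{m+2}}\cdots$. Theorem. (1) For every superpartition $\Lambda$ of $(n|m)$ there are integers $N_\Lambda^\Omega$, indexed by the $\Omega\vdash(n|m)$ with $\Omega<\Lambda'$ in the Bruhat order (finitely many), such that in infinitely many variables $$\overleftarrow{e_\Lambda}=m_{\Lambda'}+\sum_{\Omega<\Lambda'}N_\Lambda^\Omega\,m_\Omega .$$ (2) For all $n,m\ge 0$, $\{e_\Lambda:\Lambda\vdash(n|m)\}$ is a $\mathbb Z$-basis of $\mathscr P^{S_\infty}_{(n|m)}(\mathbb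 Z)$. (3) For every $N\ge 0$, in $N$ pairs of variables, the ring $\mathbb Z[x_1,\dots,x_N,\theta_1,\dots,\theta_N]^{S_N}$ is generated by $e_1,\dots,e_N,\tilde e_0,\dots,\tilde e_{N-1}$, and these generators are algebraically independent over $\mathbb Z$: there is an injective ring homomorphism from the superpolynomial ring in $N$ commuting and $N$ anticommuting indeterminates that sends the commuting ones to $e_1,\dots,e_N$ and the anticommuting ones to $\tilde e_0,\dots,\tilde e_{N-1}$. -/

import Mathlib

open scoped TensorProduct

/-! ## Superpartitions -/

/-- A superpartition `Λ = (Λᵃ; Λˢ)` of `(n|m)`: `Λᵃ` is a partition with `m` distinct parts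
(a part equal to `0` is allowed), i.e. a set of `m` natural numbers, and `Λˢ` is an ordinary
partition, given by the multiset of its positive parts (trailing zeros are immaterial);
the parts of `Λᵃ` and `Λˢ` add up to `n`. -/
@[ext]
structure SPar (n m : ℕ) where
  /-- the antisymmetric component `Λᵃ` -/
  anti : Finset ℕ
  /-- the positive parts of the symmetric component `Λˢ` -/
  symm : Multiset ℕ
  card_anti : anti.card = m
  symm_pos : 0 ∉ symm
  sum_eq : anti.val.sum + symm.sum = n

namespace SPar

variable {n m : ℕ}

/-- All parts of `Λ`, i.e. the parts of the partition `Λ*` (with a possible zero part). -/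
def parts (Λ : SPar n m) : Multiset ℕ := Λ.anti.val + Λ.symm

/-- The strictly decreasing sequence `Λᵃ = (Λ₁ > ⋯ > Λₘ)`. -/
def antiList (Λ : SPar n m) : List ℕ := Λ.anti.sort (· ≥ ·)

/-- The decreasing sequence of the positive parts of `Λˢ`. -/
def symmList (Λ : SPar n m) : List ℕ := Λ.symm.sort (· ≥ ·)

/-- The composition `Λᶜ`: the semicolon is replaced by a comma. -/
def toComp (Λ : SPar n m) : List ℕ := Λ.antiList ++ Λ.symmList

/-- The length `ℓ(Λ)`: the fermionic degree `m` plus the number of positive parts of `Λˢ`. -/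
def length (Λ : SPar n m) : ℕ := m + Λ.symm.card

/-- The number of parts of `Λ` that are larger than `b`. This is the length of the
`(b+1)`-st column (of boxes) of the diagram of `Λ`. -/
def numGT (Λ : SPar n m) (b : ℕ) : ℕ := (Λ.parts.filter (b < ·)).card

/-- The column lengths of the diagram: the parts of `(Λ*)'`, with some additional zeros. -/
def columns (Λ : SPar n m) : Multiset ℕ := (Multiset.range n).map Λ.numGT

theorem sum_parts (Λ : SPar n m) : Λ.parts.sum = n := by
  simpa [parts] using Λ.sum_eq

theorem numGT_injOn (Λ : SPar n m) : Set.InjOn Λ.numGT Λ.anti := by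
  have key : ∀ b ∈ Λ.anti, ∀ c ∈ Λ.anti, b < c → Λ.numGT c < Λ.numGT b := by
    intro b _ c hc hbc
    apply Multiset.card_lt_card
    refine lt_of_le_of_ne
      (Multiset.monotone_filter_right _ fun x hx => lt_trans hbc hx) fun h => ?_
    have h1 : c ∈ Λ.parts.filter (b < ·) := by
      simp [parts, hbc, Finset.mem_def.1 hc]
    rw [← h] at h1
    simp at h1
  intro b hb c hc h
  rcases lt_trichotomy b c with hlt | heq | hlt
  · exact absurd h (key b hb c hc hlt).ne'
  · exact heq
  · exact absurd h (key c hc b hb hlt).ne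

/-- The antisymmetric component of the conjugate: `Λ'ᵃ = {Card {k : Λₖ > b} : b ∈ Λᵃ}`. -/
def conjAnti (Λ : SPar n m) : Finset ℕ := Λ.anti.image Λ.numGT

/-- The positive parts of the symmetric component of the conjugate:
`Λ'ˢ = ((Λ*)' \ Λ'ᵃ)⁺`, a difference of multisets. -/
def conjSymm (Λ : SPar n m) : Multiset ℕ := (Λ.columns - Λ.conjAnti.val).filter (0 < ·)

theorem conjAnti_val (Λ : SPar n m) : Λ.conjAnti.val = Λ.anti.val.map Λ.numGT :=
  Finset.image_val_of_injOn Λ.numGT_injOn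

theorem conjAnti_filter_le (Λ : SPar n m) :
    Λ.conjAnti.val.filter (0 < ·) ≤ Λ.columns := by
  rw [conjAnti_val, Multiset.filter_map, columns]
  apply Multiset.map_le_map
  rw [Multiset.le_iff_subset (Multiset.Nodup.filter _ Λ.anti.nodup)]
  intro b hb
  simp only [Multiset.mem_filter, Function.comp_apply, numGT, Multiset.card_pos_iff_exists_mem]
    at hb
  obtain ⟨-, p, hp⟩ := hb
  have h2 := Multiset.le_sum_of_mem hp.1
  rw [sum_parts] at h2
  simp only [Multiset.mem_range]
  omega

theorem sum_columns (Λ : SPar n m) : Λ.columns.sum = n := by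
  have h : ∀ s : Multiset ℕ, (∀ p ∈ s, p ≤ n) →
      ((Multiset.range n).map fun b => (s.filter (b < ·)).card).sum = s.sum := by
    intro s
    induction s using Multiset.induction_on with
    | empty => simp
    | cons p s ih =>
      intro hs
      have hp : p ≤ n := hs p (Multiset.mem_cons_self p s)
      rw [Multiset.sum_cons, ← ih fun q hq => hs q (Multiset.mem_cons_of_mem hq)]
      simp only [Multiset.filter_cons, Multiset.card_add, Multiset.sum_map_add]
      congr 1
      have h1 : ∀ b : ℕ, (if b < p then ({p} : Multiset ℕ) else 0).card
          = if b < p then 1 else 0 := by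
        intro b; split_ifs <;> simp
      simp only [h1]
      change ∑ b ∈ Finset.range n, (if b < p then 1 else 0) = p
      rw [← Finset.sum_filter]
      have h2 : (Finset.range n).filter (· < p) = Finset.range p := by
        ext b; simp; omega
      simp [h2]
  have h3 := h Λ.parts fun p hp => by
    have := Multiset.le_sum_of_mem hp
    rwa [sum_parts] at this
  rw [sum_parts] at h3
  exact h3

theorem sum_filter_pos (s : Multiset ℕ) : (s.filter (0 < ·)).sum = s.sum := by
  induction s using Multiset.induction_on with
  | empty => simp
  | cons p s ih =>
    rcases Nat.eq_zero_or_pos p with h | h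
    · simp [h, ih]
    · simp [h, ih]

/-- The conjugate superpartition `Λ'`, whose diagram (boxes and circles) is the transpose of the
diagram of `Λ`. The circle at the end of a row of `b` boxes lies in the column `b + 1`, below
`Card {k : Λₖ > b}` boxes. -/
def conj (Λ : SPar n m) : SPar n m where
  anti := Λ.conjAnti
  symm := Λ.conjSymm
  card_anti := by
    rw [conjAnti, Finset.card_image_of_injOn Λ.numGT_injOn, Λ.card_anti]
  symm_pos := fun h => by simpa using (Multiset.mem_filter.1 h).2
  sum_eq := by
    have h1 : Λ.conjSymm = Λ.columns.filter (0 < ·) - Λ.conjAnti.val.filter (0 < ·) := by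
      rw [conjSymm, Multiset.filter_sub]
    have h2 : Λ.conjAnti.val.filter (0 < ·) ≤ Λ.columns.filter (0 < ·) := by
      have := Multiset.filter_le_filter (0 < ·) Λ.conjAnti_filter_le
      simpa [Multiset.filter_filter] using this
    have h3 := congrArg Multiset.sum (add_tsub_cancel_of_le h2)
    rw [Multiset.sum_add, ← h1, sum_filter_pos, sum_filter_pos, sum_columns] at h3
    exact h3

end SPar

/-! ## The Bruhat order -/

/-- The product `s_{i₁} s_{i₂} ⋯` of the elementary transpositions `sᵢ = (i, i+1)` named by a
word. Positions are numbered from `0`, and there are infinitely many of them. -/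
def wordProd (w : List ℕ) : Equiv.Perm ℕ := (w.map fun i => Equiv.swap i (i + 1)).prod

/-- A word is reduced if no shorter word has the same product. -/
def IsReducedWord (w : List ℕ) : Prop :=
  ∀ w' : List ℕ, wordProd w' = wordProd w → w.length ≤ w'.length

/-- The Bruhat order on (finitary) permutations: a reduced word of `u` is a subword of a reduced
word of `v`. -/
def PermBruhatLE (u v : Equiv.Perm ℕ) : Prop :=
  ∃ w w' : List ℕ, IsReducedWord w ∧ IsReducedWord w' ∧
    wordProd w = u ∧ wordProd w' = v ∧ w.Sublist w'

/-- The entries of a composition, padded by infinitely many zeros. -/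
def compEntry (c : List ℕ) (i : ℕ) : ℕ := c.getD i 0

/-- The partition `c⁺` obtained by reordering the parts of `c` non-increasingly. -/
def compSort (c : List ℕ) : List ℕ := c.mergeSort (fun a b => decide (b ≤ a))

/-- `w` is the product of a word and `c = w c⁺`, where `(w c)_i = c_{w⁻¹ i}`. -/
def SortsBy (c : List ℕ) (w : List ℕ) : Prop :=
  ∀ i, compEntry c i = compEntry (compSort c) ((wordProd w)⁻¹ i)

/-- `u` is the permutation `w_c` of minimal length among those with `c = u c⁺`. -/
def IsMinSorting (c : List ℕ) (u : Equiv.Perm ℕ) : Prop :=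
  ∃ w : List ℕ, wordProd w = u ∧ SortsBy c w ∧ ∀ w' : List ℕ, SortsBy c w' → w.length ≤ w'.length

/-- Dominance order `d ≤ c` on partitions: all partial sums of `d` are at most those of `c`. -/
def DominanceLE (d c : List ℕ) : Prop :=
  ∀ k, ∑ i ∈ Finset.range k, compEntry d i ≤ ∑ i ∈ Finset.range k, compEntry c i

/-- The Bruhat order `d ≤ c` on compositions (finite lists, up to trailing zeros): either
`d⁺ < c⁺` in the dominance order, or `d⁺ = c⁺` and `w_c ≤ w_d`. -/
def CompBruhatLE (d c : List ℕ) : Prop :=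
  (DominanceLE (compSort d) (compSort c) ∧ compEntry (compSort d) ≠ compEntry (compSort c)) ∨
  (compEntry (compSort d) = compEntry (compSort c) ∧
    ∃ u v : Equiv.Perm ℕ, IsMinSorting c u ∧ IsMinSorting d v ∧ PermBruhatLE u v)

/-- The Bruhat order `Ω ≤ Λ` on superpartitions of `(n|m)`. -/
def SPar.BruhatLE {n m : ℕ} (Ω Λ : SPar n m) : Prop := CompBruhatLE Ω.toComp Λ.toComp

/-- The strict Bruhat order `Ω < Λ`. -/
def SPar.BruhatLT {n m : ℕ} (Ω Λ : SPar n m) : Prop := Ω.BruhatLE Λ ∧ Ω ≠ Λ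

/-! ## Superpolynomials -/

noncomputable section

/-- The ring `ℤ[x₁,…,x_N, θ₁,…,θ_N]` of superpolynomials: the Grassmann algebra on
`θ₁,…,θ_N` over the polynomial ring in `x₁,…,x_N`. -/
abbrev SuperPoly (N : ℕ) : Type :=
  MvPolynomial (Fin N) ℤ ⊗[ℤ] ExteriorAlgebra ℤ (Fin N → ℤ)

/-- The commuting variable `xᵢ`. -/
def xVar {N : ℕ} (i : Fin N) : SuperPoly N := MvPolynomial.X i ⊗ₜ[ℤ] 1

/-- The anticommuting variable `θᵢ`. -/
def thetaVar {N : ℕ} (i : Fin N) : SuperPoly N :=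
  1 ⊗ₜ[ℤ] ExteriorAlgebra.ι ℤ (Pi.single i (1 : ℤ))

/-- The diagonal action `𝒦_σ` of a permutation: `xᵢ ↦ x_{σ i}` and `θᵢ ↦ θ_{σ i}`. -/
def permAct {N : ℕ} (σ : Equiv.Perm (Fin N)) : SuperPoly N →ₐ[ℤ] SuperPoly N :=
  Algebra.TensorProduct.map (MvPolynomial.rename σ)
    (ExteriorAlgebra.map (LinearMap.funLeft ℤ ℤ σ.symm))

/-- The ring of symmetric superpolynomials in `N` commuting and `N` anticommuting variables. -/
def SymSuperPoly (N : ℕ) : Subalgebra ℤ (SuperPoly N) where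
  carrier := {f | ∀ σ : Equiv.Perm (Fin N), permAct σ f = f}
  mul_mem' := by
    intro f g hf hg σ
    rw [map_mul, hf σ, hg σ]
  add_mem' := by
    intro f g hf hg σ
    rw [map_add, hf σ, hg σ]
  algebraMap_mem' := by
    intro r σ
    exact (permAct σ).commutes r

/-- The superpolynomials that are homogeneous of degree `n` in `x` and `m` in `θ`. -/
def homogSuperPoly (N n m : ℕ) : Submodule ℤ (SuperPoly N) :=
  Submodule.span ℤ {f | ∃ (p : MvPolynomial (Fin N) ℤ) (w : ExteriorAlgebra ℤ (Fin N → ℤ)),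
    p.IsHomogeneous n ∧ w ∈ ⋀[ℤ]^m (Fin N → ℤ) ∧ f = p ⊗ₜ[ℤ] w}

/-- Setting the last variables to zero: `x_{N+1} = θ_{N+1} = 0`. -/
def restrictSuper (N : ℕ) : SuperPoly (N + 1) →ₐ[ℤ] SuperPoly N :=
  Algebra.TensorProduct.map
    (MvPolynomial.aeval
      (Fin.lastCases (0 : MvPolynomial (Fin N) ℤ) fun i : Fin N => MvPolynomial.X i))
    (ExteriorAlgebra.map (LinearMap.funLeft ℤ ℤ (Fin.castSucc : Fin N → Fin (N + 1))))

/-- Families with one superpolynomial in `N` pairs of variables for each `N`. A superfunction in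
infinitely many variables is the family of its truncations `x_i = θ_i = 0` for `i > N`. -/
abbrev SuperFamily : Type := ∀ N : ℕ, SuperPoly N

/-- The module of symmetric superfunctions of degree `(n|m)` in infinitely many variables `x_i`,
`θ_i`, with integer coefficients: the inverse limit over `N` of the modules of symmetric
superpolynomials of degree `(n|m)` in `N` pairs of variables. -/
def SymSuper (n m : ℕ) : Submodule ℤ SuperFamily where
  carrier := {f | (∀ N, f N ∈ SymSuperPoly N) ∧ (∀ N, f N ∈ homogSuperPoly N n m) ∧
    ∀ N, restrictSuper N (f (N + 1)) = f N}
  add_mem' := by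
    intro f g hf hg
    refine ⟨fun N => add_mem (hf.1 N) (hg.1 N), fun N => add_mem (hf.2.1 N) (hg.2.1 N),
      fun N => ?_⟩
    rw [Pi.add_apply, map_add, hf.2.2 N, hg.2.2 N, Pi.add_apply]
  zero_mem' := ⟨fun _ => zero_mem _, fun _ => zero_mem _, fun _ => map_zero _⟩
  smul_mem' := by
    intro c f hf
    refine ⟨fun N => Subalgebra.smul_mem _ (hf.1 N) c, fun N => Submodule.smul_mem _ c (hf.2.1 N),
      fun N => ?_⟩
    rw [Pi.smul_apply, map_smul, hf.2.2 N, Pi.smul_apply]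

/-! ## Supermonomials and elementary superfunctions -/

/-- The term `θ₁ ⋯ θ_m x^Λ` in `N ≥ m` pairs of variables. -/
def leadingTerm {n m : ℕ} (Λ : SPar n m) (N : ℕ) (h : m ≤ N) : SuperPoly N :=
  MvPolynomial.monomial (Finsupp.equivFunOnFinite.symm fun i : Fin N => compEntry Λ.toComp i) 1
    ⊗ₜ[ℤ] ExteriorAlgebra.ιMulti ℤ m fun k : Fin m => Pi.single (Fin.castLE h k) (1 : ℤ)

open Classical in
/-- The symmetric supermonomial `m_Λ` in `N` pairs of variables: the sum of the distinct terms
among the `𝒦_σ (θ₁ ⋯ θ_m x^Λ)`; it is zero if `Λ` has more than `N` parts. -/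
def superMonomialN {n m : ℕ} (Λ : SPar n m) (N : ℕ) : SuperPoly N :=
  if h : Λ.length ≤ N then
    ∑ t ∈ Finset.univ.image (fun σ : Equiv.Perm (Fin N) =>
      permAct σ (leadingTerm Λ N (le_trans (Nat.le_add_right m _) h))), t
  else 0

/-- The symmetric supermonomial `m_Λ` in infinitely many variables. -/
def superMonomial {n m : ℕ} (Λ : SPar n m) : SuperFamily := fun N => superMonomialN Λ N

/-- The elementary symmetric polynomial `e_k = ∑_{#J = k} ∏_{j ∈ J} x_j` in `N` pairs of
variables. -/
def elemBosonN (N k : ℕ) : SuperPoly N :=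
  (∑ J ∈ Finset.powersetCard k (Finset.univ : Finset (Fin N)), ∏ j ∈ J, MvPolynomial.X j) ⊗ₜ[ℤ] 1

/-- The fermionic elementary superpolynomial `ẽ_k = ∑_i ∑_{#J = k, i ∉ J} θ_i ∏_{j ∈ J} x_j` in
`N` pairs of variables; `ẽ_0 = ∑_i θ_i`. -/
def elemFermionN (N k : ℕ) : SuperPoly N :=
  ∑ i : Fin N, (∑ J ∈ Finset.powersetCard k (Finset.univ.erase i), ∏ j ∈ J, MvPolynomial.X j)
    ⊗ₜ[ℤ] ExteriorAlgebra.ι ℤ (Pi.single i (1 : ℤ))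

/-- The bosonic elementary symmetric superfunction `e_k`. -/
def elemBoson (k : ℕ) : SuperFamily := fun N => elemBosonN N k

/-- The fermionic elementary symmetric superfunction `ẽ_k`. -/
def elemFermion (k : ℕ) : SuperFamily := fun N => elemFermionN N k

/-- `e_Λ = ẽ_{Λ₁} ⋯ ẽ_{Λ_m} e_{Λ_{m+1}} e_{Λ_{m+2}} ⋯`. -/
def elemSuper {n m : ℕ} (Λ : SPar n m) : SuperFamily :=
  (Λ.antiList.map elemFermion).prod * (Λ.symmList.map elemBoson).prod

/-- `e_Λ` with the fermions in reversed order: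
`ẽ_{Λ_m} ⋯ ẽ_{Λ₁} e_{Λ_{m+1}} e_{Λ_{m+2}} ⋯`. -/
def elemSuperRev {n m : ℕ} (Λ : SPar n m) : SuperFamily :=
  (Λ.antiList.reverse.map elemFermion).prod * (Λ.symmList.map elemBoson).prod

end

/-! ## Words, inversions and insertion sort -/

/-! Everything follows from one triangularity statement, a super version of the Gale–Ryser argument.
In N pairs of variables a symmetric superpolynomial is determined by its coefficients at the leading
terms θ_1⋯θ_m x^Γ (`symmSuperPoly_eq_zero`), and these functionals are dual to the supermonomials
(`leadCoeff_superMonomialN`). The coefficient of m_Γ in the reversed e_Λ is therefore a signed count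
of 0-1 matrices: the row sums are the parts of Λ, the column sums are the exponents of Γ, and the
row of the k-th antisymmetric part has a hole in the column `g k` that carries its θ.

The sorted column sums are dominated by the conjugate partition (`sum_columns_le`). When they equal
it, the matrix is forced: after sorting the columns every row is left-justified
(`mem_iff_of_columns_eq`). The hole of a fermionic row of length b then lies at a sorted position at
least b, so the exponent there is at most the number of parts larger than b, which is the matching
part of Λ'ᵃ. A pigeonhole argument turns this into Γᵃ ≤ Λ'ᵃ entry by entry. For Γ = Λ' a single
matrix with the identity placement of the θ's remains, and the reversal of the fermions makes its
sign +1.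

To reach the Bruhat order, the sorting permutation of a superpartition is given an explicit reduced
word `sortWord`, shown minimal by counting inversions. For equal sorted parts, an entrywise
inequality of the antisymmetric parts makes one such word a subword of the other
(`bruhatLE_of_sortedEntry_eq`).

Since conjugation is a bijection of a finite set, the transition matrix is unitriangular for the
linear invariant `rank`, which gives the integral basis; undoing the reversal changes only signs. In
N pairs of variables, generation follows by truncating this expansion. For independence, the
monomials x^α θ_K go to reversed e_Λ whose conjugates have length at most N, so their leading terms
survive truncation and triangularity still applies. -/

theorem wordProd_nil : wordProd [] = 1 := rfl

theorem wordProd_cons (k : ℕ) (w : List ℕ) :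
    wordProd (k :: w) = Equiv.swap k (k + 1) * wordProd w := by
  simp [wordProd]

theorem wordProd_append (w w' : List ℕ) : wordProd (w ++ w') = wordProd w * wordProd w' := by
  simp [wordProd]

theorem wordProd_cons_inv_apply (k : ℕ) (w : List ℕ) (j : ℕ) :
    (wordProd (k :: w))⁻¹ j = (wordProd w)⁻¹ (Equiv.swap k (k + 1) j) := by
  rw [wordProd_cons, mul_inv_rev, Equiv.swap_inv, Equiv.Perm.mul_apply]

/-- A run of consecutive letters is a cycle; such cycles are the insertion steps of `sortWord`. -/
theorem wordProd_range'_inv_apply (d i j : ℕ) :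
    (wordProd (List.range' i d))⁻¹ j =
      if j = i then i + d else if i < j ∧ j ≤ i + d then j - 1 else j := by
  induction d generalizing i j with
  | zero =>
    simp only [List.range'_zero, wordProd_nil, inv_one, Equiv.Perm.one_apply]
    split_ifs <;> omega
  | succ d ih =>
    rw [List.range'_succ, wordProd_cons_inv_apply, ih, Equiv.swap_apply_def]
    split_ifs <;> omega

/-- The inversions of a sequence with respect to the decreasing order. -/
def inversions (f : ℕ → ℕ) : Set (ℕ × ℕ) := {x | x.1 < x.2 ∧ f x.1 < f x.2}

/-- An antitone sequence has no inversions, and an adjacent swap can create only one, at the swapped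
pair; all others are transported by the swap. -/
theorem inversions_comp_wordProd {s : ℕ → ℕ} (hs : Antitone s) (w : List ℕ) :
    (inversions fun i => s ((wordProd w)⁻¹ i)).Finite ∧
      (inversions fun i => s ((wordProd w)⁻¹ i)).ncard ≤ w.length := by
  induction w with
  | nil =>
    have : (inversions fun i => s ((wordProd [])⁻¹ i)) = ∅ := by
      ext x
      simp only [inversions, wordProd_nil, inv_one, Equiv.Perm.one_apply, Set.mem_ofPred_eq,
        Set.mem_empty_iff_false, iff_false, not_and, not_lt]
      exact fun h => hs h.le
    rw [this]
    simp
  | cons k w ih =>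
    obtain ⟨hfin, hcard⟩ := ih
    have hsub : (inversions fun i => s ((wordProd (k :: w))⁻¹ i)) ⊆
        insert (k, k + 1) (Prod.map (Equiv.swap k (k + 1)) (Equiv.swap k (k + 1)) ''
          (inversions fun i => s ((wordProd w)⁻¹ i))) := by
      rintro ⟨a, b⟩ ⟨hab, hf⟩
      simp only [wordProd_cons_inv_apply] at hf hab
      by_cases h : a = k ∧ b = k + 1
      · left; rw [h.1, h.2]
      · right
        refine ⟨(Equiv.swap k (k + 1) a, Equiv.swap k (k + 1) b), ⟨?_, hf⟩, by simp⟩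
        simp only [Equiv.swap_apply_def]
        split_ifs <;> omega
    have hfin' := (hfin.image (Prod.map (Equiv.swap k (k + 1)) (Equiv.swap k (k + 1)))).insert
      (k, k + 1)
    refine ⟨hfin'.subset hsub, (Set.ncard_le_ncard hsub hfin').trans
      ((Set.ncard_insert_le _ _).trans ?_)⟩
    have := Set.ncard_image_le (f := Prod.map (Equiv.swap k (k + 1)) (Equiv.swap k (k + 1))) hfin
    simp only [List.length_cons]
    omega

/-- Among the positions with a larger entry than position `i`, at most `i` lie to its left; each of
the others gives an inversion. This is the lower bound that `sortWord` attains. -/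
theorem sum_le_ncard_inversions {f p : ℕ → ℕ} {m : ℕ} (hfin : (inversions f).Finite)
    (h : ∀ i < m, ∃ T : Finset ℕ, p i ≤ T.card ∧ ∀ j ∈ T, f i < f j) :
    ∑ i ∈ Finset.range m, (p i - i) ≤ (inversions f).ncard := by
  choose! T hT hT' using h
  let U : Finset (ℕ × ℕ) := (Finset.range m).biUnion fun i =>
    ((T i).filter (i < ·)).map ⟨fun j => (i, j), fun a b hab => by simpa using hab⟩
  have hU : U.card = ∑ i ∈ Finset.range m, ((T i).filter (i < ·)).card := by
    rw [Finset.card_biUnion]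
    · simp
    · intro i _ j _ hij
      rw [Function.onFun, Finset.disjoint_left]
      rintro ⟨a, b⟩ h1 h2
      simp only [Finset.mem_map] at h1 h2
      obtain ⟨_, _, rfl, _⟩ := h1
      obtain ⟨_, _, rfl, _⟩ := h2
      exact hij rfl
  have hsub : (U : Set (ℕ × ℕ)) ⊆ inversions f := by
    rintro ⟨a, b⟩ hab
    simp only [U, Finset.coe_biUnion, Set.mem_iUnion, Finset.mem_coe, Finset.mem_range,
      Finset.mem_map, Finset.mem_filter] at hab
    obtain ⟨i, hi, j, ⟨hj, hij⟩, rfl, rfl⟩ := hab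
    exact ⟨hij, hT' _ hi _ hj⟩
  rw [← Set.ncard_coe_finset] at hU
  refine le_trans ?_ (Set.ncard_le_ncard hsub hfin)
  rw [hU]
  refine Finset.sum_le_sum fun i hi => ?_
  have hi := Finset.mem_range.1 hi
  have h1 := Finset.card_filter_add_card_filter_not (s := T i) (i < ·)
  have h2 : ((T i).filter fun j => ¬ i < j).card ≤ i := by
    have : ((T i).filter fun j => ¬ i < j) ⊆ Finset.range i := by
      intro j hj
      simp only [Finset.mem_filter, not_lt] at hj
      have := hT' i hi j hj.1
      rcases hj.2.lt_or_eq with h | rfl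
      · simpa using h
      · omega
    simpa using Finset.card_le_card this
  have := hT i hi
  omega

/-- The word that moves the entries in the positions `i, i + 1, …` to the increasing sequence of
positions given by a list; its inverse is the corresponding Grassmannian permutation. -/
def sortWord : ℕ → List ℕ → List ℕ
  | _, [] => []
  | i, p :: ps => sortWord (i + 1) ps ++ List.range' i (p - i)

theorem sortWord_cons_inv_apply (i p : ℕ) (ps : List ℕ) (j : ℕ) :
    (wordProd (sortWord i (p :: ps)))⁻¹ j =
      (wordProd (List.range' i (p - i)))⁻¹ ((wordProd (sortWord (i + 1) ps))⁻¹ j) := by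
  rw [sortWord, wordProd_append, mul_inv_rev, Equiv.Perm.mul_apply]

theorem sortWord_inv_apply_of_lt (ps : List ℕ) (i j : ℕ) (h : j < i) :
    (wordProd (sortWord i ps))⁻¹ j = j := by
  induction ps generalizing i with
  | nil => rfl
  | cons p ps ih =>
    rw [sortWord_cons_inv_apply, ih _ (by omega), wordProd_range'_inv_apply]
    split_ifs <;> omega

theorem sortWord_inv_apply_add (ps : List ℕ) (hps : ps.Pairwise (· < ·)) (i : ℕ)
    (hi : ∀ p ∈ ps, i ≤ p) (k : ℕ) (hk : k < ps.length) :
    (wordProd (sortWord i ps))⁻¹ (i + k) = ps[k] := by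
  induction ps generalizing i k with
  | nil => simp at hk
  | cons p ps ih =>
    rw [List.pairwise_cons] at hps
    have hp := hi p List.mem_cons_self
    rw [sortWord_cons_inv_apply]
    cases k with
    | zero =>
      rw [sortWord_inv_apply_of_lt _ _ _ (by omega), wordProd_range'_inv_apply]
      simp only [List.getElem_cons_zero]
      split_ifs <;> omega
    | succ k =>
      have hk' : k < ps.length := by simpa using hk
      -- `ps[k]` exceeds `p`, so the cycle on `i, …, p` does not move it.
      have h1 := hps.1 _ (List.getElem_mem hk')
      rw [show i + (k + 1) = i + 1 + k by ring,
        ih hps.2 (i + 1) (fun q hq => lt_of_le_of_lt hp (hps.1 q hq)) k hk',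
        wordProd_range'_inv_apply]
      simp only [List.getElem_cons_succ]
      split_ifs <;> omega

/-- The cycle of the head is increasing on the positions above `i`, and the tail keeps these
positions above `i` because it fixes all others (`key`). -/
theorem sortWord_inv_strictMono (ps : List ℕ) (i j j' : ℕ) (hj : i + ps.length ≤ j)
    (hjj : j < j') :
    (wordProd (sortWord i ps))⁻¹ j < (wordProd (sortWord i ps))⁻¹ j' := by
  induction ps generalizing i with
  | nil => exact hjj
  | cons p ps ih =>
    simp only [List.length_cons] at hj
    have key : ∀ a, i < a → i < (wordProd (sortWord (i + 1) ps))⁻¹ a := by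
      intro a ha
      by_contra h
      have h1 := sortWord_inv_apply_of_lt ps (i + 1) _ (Nat.lt_succ_of_le (not_lt.1 h))
      have h2 := (wordProd (sortWord (i + 1) ps))⁻¹.injective h1
      omega
    have h1 := ih (i + 1) (by omega)
    have h2 := key j (by omega)
    have h3 := key j' (by omega)
    simp only [sortWord_cons_inv_apply, wordProd_range'_inv_apply]
    split_ifs <;> omega

theorem length_sortWord (ps : List ℕ) (i : ℕ) :
    (sortWord i ps).length = ∑ k ∈ Finset.range ps.length, (ps.getD k 0 - (i + k)) := by
  induction ps generalizing i with
  | nil => simp [sortWord]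
  | cons p ps ih =>
    rw [sortWord, List.length_append, ih, List.length_range', List.length_cons,
      Finset.sum_range_succ']
    simp only [List.getD_cons_succ, List.getD_cons_zero, add_zero]
    congr 1
    exact Finset.sum_congr rfl fun k _ => by congr 1; ring

/-- Run by run, the shorter run is a prefix of the longer one. This is where subwords for the Bruhat
order come from. -/
theorem sortWord_sublist {ps qs : List ℕ} (h : List.Forall₂ (· ≤ ·) ps qs) (i : ℕ) :
    (sortWord i ps).Sublist (sortWord i qs) := by
  induction h generalizing i with
  | nil => exact List.Sublist.refl _
  | cons hpq _ ih =>
    exact (ih (i + 1)).append (List.range'_sublist_right.2 (Nat.sub_le_sub_right hpq i))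

/-! ## Sorted sequences -/

/-- In a non-increasing list the entries above `v` form an initial segment. Sorted sequences can
thus be compared through their counting functions. -/
theorem lt_getD_iff_of_sorted {l : List ℕ} (hl : l.Pairwise (· ≥ ·)) (v p : ℕ) :
    v < l.getD p 0 ↔ p < (l.filter (v < ·)).length := by
  induction l generalizing p with
  | nil => simp
  | cons a l ih =>
    rw [List.pairwise_cons] at hl
    by_cases hv : v < a
    · rw [List.filter_cons_of_pos (by simpa using hv)]
      cases p with
      | zero => simpa using hv
      | succ p => simpa using ih hl.2 p
    · have h0 : l.filter (v < ·) = [] := by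
        rw [List.filter_eq_nil_iff]
        intro b hb
        have := hl.1 b hb
        simp only [decide_eq_true_eq]
        omega
      rw [List.filter_cons_of_neg (by simpa using hv), h0]
      simp only [List.length_nil, not_lt_zero, iff_false, not_lt]
      cases p with
      | zero => simpa using hv
      | succ p =>
        rw [List.getD_cons_succ]
        have := (ih hl.2 p).not
        simp only [h0, List.length_nil, not_lt_zero, not_false_eq_true, iff_true, not_lt] at this
        exact this

theorem pairwise_compSort (c : List ℕ) : (compSort c).Pairwise (· ≥ ·) := by
  have := List.pairwise_mergeSort (le := fun a b : ℕ => decide (b ≤ a))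
    (by simp; omega) (by simp; omega) c
  simpa [compSort] using this

theorem compSort_perm (c : List ℕ) : (compSort c).Perm c := List.mergeSort_perm _ _

theorem lt_compEntry_compSort (c : List ℕ) (v p : ℕ) :
    v < compEntry (compSort c) p ↔ p < (c.filter (v < ·)).length := by
  rw [compEntry, lt_getD_iff_of_sorted (pairwise_compSort c),
    ((compSort_perm c).filter _).length_eq]

theorem antitone_compEntry_compSort (c : List ℕ) : Antitone (compEntry (compSort c)) := by
  intro p q hpq
  by_contra h
  rw [not_le, lt_compEntry_compSort] at h
  exact absurd ((lt_compEntry_compSort c _ p).2 (lt_of_le_of_lt hpq h)) (lt_irrefl _)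

theorem card_filter_lt_compEntry (c : List ℕ) (v K : ℕ) (hK : c.length ≤ K) :
    ((Finset.range K).filter fun j => v < compEntry c j).card = (c.filter (v < ·)).length := by
  induction c generalizing K with
  | nil => simp [compEntry]
  | cons a c ih =>
    obtain ⟨K, rfl⟩ : ∃ K', K = K' + 1 := ⟨K - 1, by simp at hK; omega⟩
    have ih := ih K (by simpa using hK)
    rw [Finset.card_filter] at ih ⊢
    rw [Finset.sum_range_succ', List.filter_cons]
    have ih' : (∑ i ∈ Finset.range K, if v < compEntry (a :: c) (i + 1) then 1 else 0) =
      (c.filter (v < ·)).length := ih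
    rw [ih', show compEntry (a :: c) 0 = a from rfl]
    by_cases h : v < a <;> simp [h]

/-! ## Combinatorics of superpartitions -/

namespace SPar

variable {n m : ℕ}

/-- The parts of `Λ` in non-increasing order, padded by zeros. -/
def sortedEntry (Λ : SPar n m) (p : ℕ) : ℕ := compEntry (compSort Λ.toComp) p

theorem coe_antiList (Λ : SPar n m) : (Λ.antiList : Multiset ℕ) = Λ.anti.val :=
  Finset.sort_eq _ _

theorem coe_symmList (Λ : SPar n m) : (Λ.symmList : Multiset ℕ) = Λ.symm :=
  Multiset.sort_eq _ _

theorem coe_toComp (Λ : SPar n m) : (Λ.toComp : Multiset ℕ) = Λ.parts := by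
  rw [toComp, ← Multiset.coe_add, coe_antiList, coe_symmList, parts]

theorem length_antiList (Λ : SPar n m) : Λ.antiList.length = m := by
  rw [antiList, Finset.length_sort, Λ.card_anti]

theorem length_symmList (Λ : SPar n m) : Λ.symmList.length = Λ.symm.card := by
  rw [symmList, Multiset.length_sort]

theorem length_toComp (Λ : SPar n m) : Λ.toComp.length = Λ.length := by
  rw [toComp, List.length_append, length_antiList, length_symmList, length]

theorem pairwise_antiList (Λ : SPar n m) : Λ.antiList.Pairwise (· > ·) :=
  (Finset.sortedGT_sort Λ.anti).pairwise

theorem pairwise_symmList (Λ : SPar n m) : Λ.symmList.Pairwise (· ≥ ·) :=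
  Multiset.pairwise_sort _ _

theorem length_filter_toComp (Λ : SPar n m) (v : ℕ) :
    (Λ.toComp.filter (v < ·)).length = Λ.numGT v := by
  rw [numGT, ← coe_toComp, Multiset.filter_coe, Multiset.coe_card]

/-- This adjunction is the conjugation of partitions; the facts on conjugates below are obtained
from it by comparing strict lower bounds. -/
theorem lt_sortedEntry (Λ : SPar n m) (v p : ℕ) : v < Λ.sortedEntry p ↔ p < Λ.numGT v := by
  rw [sortedEntry, lt_compEntry_compSort, length_filter_toComp]

theorem antitone_numGT (Λ : SPar n m) : Antitone Λ.numGT := by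
  intro b c hbc
  by_contra h
  rw [not_le, ← lt_sortedEntry] at h
  exact absurd ((Λ.lt_sortedEntry _ _).1 (lt_of_le_of_lt hbc h)) (lt_irrefl _)

theorem antitone_sortedEntry (Λ : SPar n m) : Antitone Λ.sortedEntry :=
  antitone_compEntry_compSort _

theorem numGT_lt_numGT (Λ : SPar n m) {b c : ℕ} (hc : c ∈ Λ.anti) (hbc : b < c) :
    Λ.numGT c < Λ.numGT b := by
  refine Multiset.card_lt_card (lt_of_le_of_ne
    (Multiset.monotone_filter_right _ fun x hx => lt_trans hbc hx) fun h => ?_)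
  have h1 : c ∈ Λ.parts.filter (b < ·) := by
    simp [parts, hbc, Finset.mem_def.1 hc]
  rw [← h] at h1
  simp at h1

/-- The topmost row of length `b` is preceded exactly by the longer rows. -/
theorem sortedEntry_numGT (Λ : SPar n m) {b : ℕ} (hb : b ∈ Λ.anti) :
    Λ.sortedEntry (Λ.numGT b) = b := by
  refine eq_of_forall_lt_iff fun v => ?_
  rw [lt_sortedEntry]
  refine ⟨fun h => ?_, fun h => Λ.numGT_lt_numGT hb h⟩
  by_contra h'
  exact absurd (Λ.antitone_numGT (not_lt.1 h')) (not_le.2 h)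

theorem le_of_mem_parts (Λ : SPar n m) {p : ℕ} (hp : p ∈ Λ.parts) : p ≤ n := by
  have := Multiset.le_sum_of_mem hp
  rwa [sum_parts] at this

theorem numGT_eq_zero (Λ : SPar n m) {v : ℕ} (hv : n ≤ v) : Λ.numGT v = 0 := by
  rw [numGT, Multiset.card_eq_zero, Multiset.filter_eq_nil]
  intro p hp
  have := Λ.le_of_mem_parts hp
  omega

theorem sortedEntry_le (Λ : SPar n m) (p : ℕ) : Λ.sortedEntry p ≤ n := by
  by_contra h
  rw [not_le, lt_sortedEntry, numGT_eq_zero _ le_rfl] at h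
  omega

/-- Zeros do not matter above a threshold, so the circled columns removed in `conjSymm` are restored
by `conjAnti`, and the count runs over all columns. -/
theorem numGT_conj (Λ : SPar n m) (v : ℕ) : Λ.conj.numGT v = Λ.sortedEntry v := by
  have h1 : Λ.conj.parts.filter (v < ·) = Λ.columns.filter (v < ·) := by
    have h2 : Λ.conjAnti.val.filter (v < ·) ≤ Λ.columns.filter (v < ·) := by
      have := Multiset.filter_le_filter (v < ·) Λ.conjAnti_filter_le
      rw [Multiset.filter_filter] at this
      rwa [Multiset.filter_congr (q := (v < ·)) fun a _ => ⟨fun h => h.1, fun h => ⟨h, by omega⟩⟩]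
        at this
    have h3 : Λ.conj.parts = Λ.conjAnti.val + (Λ.columns - Λ.conjAnti.val).filter (0 < ·) := rfl
    rw [h3, Multiset.filter_add, Multiset.filter_filter]
    have h4 : (Λ.columns - Λ.conjAnti.val).filter (fun a => v < a ∧ 0 < a) =
        (Λ.columns - Λ.conjAnti.val).filter (v < ·) :=
      Multiset.filter_congr fun a _ => ⟨fun h => h.1, fun h => ⟨h, by omega⟩⟩
    rw [h4, Multiset.filter_sub, add_tsub_cancel_of_le h2]
  rw [numGT, h1, columns, Multiset.filter_map, Multiset.card_map]
  have h5 : ((Multiset.range n).filter ((fun x => v < x) ∘ Λ.numGT)).card =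
      ((Finset.range n).filter (· < Λ.sortedEntry v)).card := by
    rw [Finset.card_def, Finset.filter_val, Finset.range_val]
    congr 1
    refine Multiset.filter_congr fun q _ => ?_
    simp only [Function.comp_apply]
    exact (Λ.lt_sortedEntry q v).symm
  rw [h5]
  have h6 : (Finset.range n).filter (· < Λ.sortedEntry v) = Finset.range (Λ.sortedEntry v) := by
    have := Λ.sortedEntry_le v
    ext q
    simp only [Finset.mem_filter, Finset.mem_range]
    omega
  rw [h6, Finset.card_range]

theorem sortedEntry_conj (Λ : SPar n m) (p : ℕ) : Λ.conj.sortedEntry p = Λ.numGT p := by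
  refine eq_of_forall_lt_iff fun v => ?_
  rw [lt_sortedEntry, numGT_conj, lt_sortedEntry]

theorem ext_of_sortedEntry {Ω Γ : SPar n m} (h : Ω.sortedEntry = Γ.sortedEntry)
    (ha : Ω.anti = Γ.anti) : Ω = Γ := by
  refine SPar.ext ha ?_
  have h1 : ∀ v, Ω.numGT v = Γ.numGT v := fun v => by
    refine eq_of_forall_lt_iff fun p => ?_
    rw [← lt_sortedEntry, ← lt_sortedEntry, h]
  have h2 : ∀ v, (Ω.symm.filter (v < ·)).card = (Γ.symm.filter (v < ·)).card := fun v => by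
    have := h1 v
    simpa [numGT, parts, ha] using this
  -- Multiplicities of positive parts are differences of consecutive counts; zero is excluded by
  -- `symm_pos`.
  have h3 : ∀ (Δ : SPar n m) (v : ℕ), Δ.symm.count (v + 1) =
      (Δ.symm.filter (v < ·)).card - (Δ.symm.filter (v + 1 < ·)).card := by
    intro Δ v
    rw [← Multiset.countP_eq_card_filter, ← Multiset.countP_eq_card_filter]
    induction Δ.symm using Multiset.induction_on with
    | empty => simp
    | cons a s ih =>
      have : s.countP (v + 1 < ·) ≤ s.countP (v < ·) := by
        rw [Multiset.countP_eq_card_filter, Multiset.countP_eq_card_filter]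
        exact Multiset.card_le_card (Multiset.monotone_filter_right _ fun x hx =>
          (Nat.lt_succ_self v).trans hx)
      rw [Multiset.count_cons, Multiset.countP_cons, Multiset.countP_cons, ih]
      split_ifs <;> omega
  refine Multiset.ext.2 fun v => ?_
  cases v with
  | zero => rw [Multiset.count_eq_zero_of_notMem Ω.symm_pos,
      Multiset.count_eq_zero_of_notMem Γ.symm_pos]
  | succ v => rw [h3, h3, h2, h2]

/-- Transposing twice restores the circles: `numGT b` is the index of the topmost row of length `b`,
and `sortedEntry` reads `b` off again. -/
theorem conj_injective : Function.Injective (conj : SPar n m → SPar n m) := by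
  have key : ∀ Λ : SPar n m, Λ.anti = Λ.conj.anti.image Λ.conj.numGT := by
    intro Λ
    change _ = (Λ.anti.image Λ.numGT).image _
    rw [Finset.image_image]
    have : Set.EqOn (Λ.conj.numGT ∘ Λ.numGT) id Λ.anti := fun b hb => by
      rw [Function.comp_apply, numGT_conj, Λ.sortedEntry_numGT hb, id]
    rw [Finset.image_congr this, Finset.image_id]
  intro Λ Γ h
  refine ext_of_sortedEntry ?_ ?_
  · funext v
    rw [← numGT_conj, ← numGT_conj, h]
  · rw [key Λ, key Γ, h]

/-- Parts and multiplicities are at most `n`, so reducing them into `Fin (n + 1)` loses nothing. -/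
instance : Finite (SPar n m) := by
  let f : SPar n m → Finset (Fin (n + 1)) × (Fin (n + 1) → Fin (n + 1)) := fun Λ =>
    (Finset.univ.filter fun i => (i : ℕ) ∈ Λ.anti, fun i => Fin.ofNat (n + 1) (Λ.symm.count (i : ℕ)))
  refine Finite.of_injective f fun Ω Γ h => ?_
  have hle : ∀ Λ : SPar n m, ∀ b ∈ Λ.anti, b ≤ n := fun Λ b hb =>
    Λ.le_of_mem_parts (Multiset.mem_add.2 (Or.inl hb))
  have hle' : ∀ Λ : SPar n m, ∀ b ∈ Λ.symm, b ≤ n := fun Λ b hb =>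
    Λ.le_of_mem_parts (Multiset.mem_add.2 (Or.inr hb))
  have hc : ∀ Λ : SPar n m, ∀ b, Λ.symm.count b ≤ n := by
    intro Λ b
    rcases Nat.eq_zero_or_pos b with rfl | hb
    · rw [Multiset.count_eq_zero_of_notMem Λ.symm_pos]; omega
    · have h1 : Λ.symm.card ≤ Λ.symm.sum := by
        have := Multiset.card_nsmul_le_sum (s := Λ.symm) (a := 1) fun x hx =>
          Nat.one_le_iff_ne_zero.2 fun h0 => Λ.symm_pos (h0 ▸ hx)
        simpa using this
      have h2 := Multiset.count_le_card b Λ.symm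
      have := Λ.sum_eq
      omega
  simp only [f, Prod.mk.injEq] at h
  refine SPar.ext (Finset.ext fun b => ?_) (Multiset.ext.2 fun b => ?_)
  · rcases lt_or_ge n b with hb | hb
    · exact ⟨fun h' => absurd (hle _ _ h') (by omega), fun h' => absurd (hle _ _ h') (by omega)⟩
    · have := Finset.ext_iff.1 h.1 ⟨b, by omega⟩
      simpa using this
  · rcases lt_or_ge n b with hb | hb
    · rw [Multiset.count_eq_zero_of_notMem fun h' => absurd (hle' _ _ h') (by omega),
        Multiset.count_eq_zero_of_notMem fun h' => absurd (hle' _ _ h') (by omega)]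
    · have := congrArg Fin.val (congrFun h.2 ⟨b, by omega⟩)
      simp only [Fin.ofNat] at this
      rwa [Nat.mod_eq_of_lt (by have := hc Ω b; omega),
        Nat.mod_eq_of_lt (by have := hc Γ b; omega)] at this

theorem conj_bijective : Function.Bijective (conj : SPar n m → SPar n m) :=
  Finite.injective_iff_bijective.1 conj_injective

/-! ## The Bruhat order on superpartitions with the same parts -/

theorem compEntry_toComp_of_lt (Λ : SPar n m) {i : ℕ} (hi : i < m) :
    compEntry Λ.toComp i = Λ.antiList[i]'(by rwa [length_antiList]) := by
  have : i < Λ.antiList.length := by rwa [length_antiList]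
  rw [compEntry, toComp, List.getD_append _ _ _ _ this, List.getD_eq_getElem _ _ this]

theorem compEntry_toComp_of_le (Λ : SPar n m) {i : ℕ} (hi : m ≤ i) :
    compEntry Λ.toComp i = Λ.symmList.getD (i - m) 0 := by
  rw [compEntry, toComp, List.getD_append_right _ _ _ _ (by rwa [length_antiList]),
    length_antiList]

theorem compEntry_toComp_mem (Λ : SPar n m) {i : ℕ} (hi : i < m) :
    compEntry Λ.toComp i ∈ Λ.anti := by
  rw [compEntry_toComp_of_lt _ hi, ← Finset.mem_sort (· ≥ ·)]
  exact List.getElem_mem _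

theorem exists_compEntry_toComp (Λ : SPar n m) {b : ℕ} (hb : b ∈ Λ.anti) :
    ∃ i < m, compEntry Λ.toComp i = b := by
  rw [← Finset.mem_sort (· ≥ ·)] at hb
  obtain ⟨i, hi, rfl⟩ := List.getElem_of_mem hb
  have hi' : i < m := by rwa [← antiList, length_antiList] at hi
  exact ⟨i, hi', Λ.compEntry_toComp_of_lt hi'⟩

theorem compEntry_toComp_lt (Λ : SPar n m) {i j : ℕ} (hij : i < j) (hj : j < m) :
    compEntry Λ.toComp j < compEntry Λ.toComp i := by
  rw [compEntry_toComp_of_lt _ hj, compEntry_toComp_of_lt _ (hij.trans hj)]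
  exact List.pairwise_iff_getElem.1 Λ.pairwise_antiList _ _ _ _ hij

theorem compEntry_toComp_anti (Λ : SPar n m) {i j : ℕ} (hi : m ≤ i) (hij : i ≤ j) :
    compEntry Λ.toComp j ≤ compEntry Λ.toComp i := by
  rw [compEntry_toComp_of_le _ hi, compEntry_toComp_of_le _ (hi.trans hij)]
  by_contra h
  rw [not_le, lt_getD_iff_of_sorted Λ.pairwise_symmList] at h
  have := (lt_getD_iff_of_sorted Λ.pairwise_symmList _ _).2
    (lt_of_le_of_lt (Nat.sub_le_sub_right hij m) h)
  exact lt_irrefl _ this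

/-- The word that sorts the composition `Λᶜ`. -/
def sortingWord (Λ : SPar n m) : List ℕ := sortWord 0 (Λ.antiList.map Λ.numGT)

theorem pairwise_map_numGT (Λ : SPar n m) : (Λ.antiList.map Λ.numGT).Pairwise (· < ·) := by
  rw [List.pairwise_map]
  refine Λ.pairwise_antiList.imp_of_mem fun {a b} ha _ hab => Λ.numGT_lt_numGT ?_ hab
  exact (Finset.mem_sort (· ≥ ·)).1 ha

theorem sortingWord_inv_apply (Λ : SPar n m) {i : ℕ} (hi : i < m) :
    (wordProd Λ.sortingWord)⁻¹ i = Λ.numGT (compEntry Λ.toComp i) := by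
  have h := sortWord_inv_apply_add _ Λ.pairwise_map_numGT 0 (fun _ _ => Nat.zero_le _) i
    (by simpa [length_antiList] using hi)
  rw [zero_add] at h
  rw [sortingWord, h, List.getElem_map, compEntry_toComp_of_lt _ hi]

theorem sortsBy_sortingWord (Λ : SPar n m) : SortsBy Λ.toComp Λ.sortingWord := by
  set v := (wordProd Λ.sortingWord)⁻¹ with hv
  have hmono : ∀ j j', m ≤ j → j < j' → v j < v j' := fun j j' hj hjj =>
    sortWord_inv_strictMono _ 0 j j' (by simpa [length_antiList] using hj) hjj
  -- for each threshold, two finite sets of the same size are compared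
  have key : ∀ t, (Finset.range (Λ.numGT t)).map (v⁻¹).toEmbedding =
      (Finset.range Λ.length).filter fun j => t < compEntry Λ.toComp j := by
    intro t
    have hcard : ((Finset.range (Λ.numGT t)).map (v⁻¹).toEmbedding).card =
        ((Finset.range Λ.length).filter fun j => t < compEntry Λ.toComp j).card := by
      rw [Finset.card_map, Finset.card_range,
        card_filter_lt_compEntry _ _ _ Λ.length_toComp.le, length_filter_toComp]
    have hA : ∀ j, j ∈ (Finset.range (Λ.numGT t)).map (v⁻¹).toEmbedding ↔ v j < Λ.numGT t := by
      intro j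
      simp only [Finset.mem_map, Finset.mem_range, Equiv.coe_toEmbedding]
      constructor
      · rintro ⟨a, ha, rfl⟩
        simpa using ha
      · exact fun h => ⟨v j, h, by simp⟩
    have hB : ∀ j, j ∈ ((Finset.range Λ.length).filter fun j => t < compEntry Λ.toComp j) ↔
        t < compEntry Λ.toComp j := by
      intro j
      simp only [Finset.mem_filter, Finset.mem_range, and_iff_right_iff_imp]
      intro h
      by_contra h'
      rw [compEntry, List.getD_eq_default _ _ (by rw [length_toComp]; omega)] at h
      omega
    have hlt : ∀ j < m, (v j < Λ.numGT t ↔ t < compEntry Λ.toComp j) := by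
      intro j hj
      rw [hv, sortingWord_inv_apply _ hj, ← lt_sortedEntry,
        sortedEntry_numGT _ (Λ.compEntry_toComp_mem hj)]
    -- The two sets agree below `m`. From `m` on both are initial segments, as `v` increases and the
    -- composition decreases, so one contains the other and equal size gives equality.
    by_cases hex : ∃ j, v j < Λ.numGT t ∧ ¬ t < compEntry Λ.toComp j
    · obtain ⟨j, hj, hj'⟩ := hex
      have hjm : m ≤ j := by
        by_contra h
        exact hj' ((hlt j (by omega)).1 hj)
      refine (Finset.eq_of_subset_of_card_le (fun i hi => ?_) hcard.le).symm
      rw [hA]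
      rw [hB] at hi
      rcases lt_or_ge i m with him | him
      · exact (hlt i him).2 hi
      · have : i < j := by
          by_contra h
          have := Λ.compEntry_toComp_anti hjm (not_lt.1 h)
          omega
        exact (hmono i j him this).trans hj
    · push Not at hex
      refine Finset.eq_of_subset_of_card_le (fun i hi => ?_) hcard.ge
      rw [hA] at hi
      rw [hB]
      exact hex i hi
  intro j
  refine eq_of_forall_lt_iff fun t => ?_
  have h := Finset.ext_iff.1 (key t) j
  simp only [Finset.mem_map, Finset.mem_range, Equiv.coe_toEmbedding, Finset.mem_filter] at h
  change _ ↔ t < Λ.sortedEntry (v j)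
  rw [lt_sortedEntry]
  constructor
  · intro ht
    have hj : j < Λ.length := by
      by_contra h'
      rw [compEntry, List.getD_eq_default _ _ (by rw [length_toComp]; omega)] at ht
      omega
    obtain ⟨a, ha, rfl⟩ := h.2 ⟨hj, ht⟩
    simpa using ha
  · exact fun ht => (h.1 ⟨v j, ht, by simp⟩).2

/-- The length of `sortingWord` is the sum of `numGT Λᵢ - i` over the antisymmetric entries. This
bounds the inversions of the composition from below, and they in turn bound the length of any
sorting word. -/
theorem length_sortingWord_le (Λ : SPar n m) (w : List ℕ) (hw : SortsBy Λ.toComp w) :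
    Λ.sortingWord.length ≤ w.length := by
  have hw' : compEntry Λ.toComp = fun i => Λ.sortedEntry ((wordProd w)⁻¹ i) := funext hw
  obtain ⟨hfin, hcard⟩ := inversions_comp_wordProd Λ.antitone_sortedEntry w
  rw [← hw'] at hfin hcard
  refine le_trans ?_ hcard
  rw [sortingWord, length_sortWord]
  simp only [zero_add]
  refine sum_le_ncard_inversions hfin fun i hi => ?_
  refine ⟨(Finset.range Λ.length).filter fun j => compEntry Λ.toComp i < compEntry Λ.toComp j,
    ?_, fun j hj => (Finset.mem_filter.1 hj).2⟩
  rw [card_filter_lt_compEntry _ _ _ Λ.length_toComp.le, length_filter_toComp]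
  have him : i < m := by simpa [length_antiList] using hi
  rw [List.getD_eq_getElem _ _ hi, List.getElem_map, compEntry_toComp_of_lt _ him]

theorem isMinSorting_sortingWord (Λ : SPar n m) :
    IsMinSorting Λ.toComp (wordProd Λ.sortingWord) :=
  ⟨_, rfl, Λ.sortsBy_sortingWord, Λ.length_sortingWord_le⟩

theorem isReducedWord_sortingWord (Λ : SPar n m) : IsReducedWord Λ.sortingWord := by
  intro w hw
  refine Λ.length_sortingWord_le w fun i => ?_
  rw [hw]
  exact Λ.sortsBy_sortingWord i

/-- Larger antisymmetric parts have earlier positions in the sorted sequence, because `numGT` is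
antitone; hence the word of `Γ` is a subword of the word of `Ω`. -/
theorem bruhatLE_of_sortedEntry_eq {Ω Γ : SPar n m} (h : Ω.sortedEntry = Γ.sortedEntry)
    (hle : ∀ i < m, compEntry Ω.toComp i ≤ compEntry Γ.toComp i) : Ω.BruhatLE Γ := by
  refine Or.inr ⟨h, _, _, Γ.isMinSorting_sortingWord, Ω.isMinSorting_sortingWord, _, _,
    Γ.isReducedWord_sortingWord, Ω.isReducedWord_sortingWord, rfl, rfl, sortWord_sublist ?_ 0⟩
  have hnum : Ω.numGT = Γ.numGT := funext fun v => by
    refine eq_of_forall_lt_iff fun p => ?_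
    rw [← lt_sortedEntry, ← lt_sortedEntry, h]
  rw [List.forall₂_iff_get]
  refine ⟨by simp [length_antiList], fun i h1 h2 => ?_⟩
  have him : i < m := by simpa [length_antiList] using h1
  have := hle i him
  rw [compEntry_toComp_of_lt _ him, compEntry_toComp_of_lt _ him] at this
  simp only [List.get_eq_getElem, List.getElem_map, hnum]
  exact Γ.antitone_numGT this

end SPar

/-! ## Coefficients of superpolynomials -/

noncomputable section

/-- The coefficient of `θ_{g 0} ∧ θ_{g 1} ∧ ⋯` in an element of the exterior algebra. -/
def thetaCoeff {N m : ℕ} (g : Fin m → Fin N) : ExteriorAlgebra ℤ (Fin N → ℤ) →ₗ[ℤ] ℤ :=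
  ExteriorAlgebra.liftAlternating
    (Pi.single (M := fun i => (Fin N → ℤ) [⋀^Fin i]→ₗ[ℤ] ℤ) m
      ((Matrix.detRowAlternating (n := Fin m) (R := ℤ)).compLinearMap (LinearMap.funLeft ℤ ℤ g)))

theorem thetaCoeff_ιMulti {N m : ℕ} (g : Fin m → Fin N) (v : Fin m → Fin N → ℤ) :
    thetaCoeff g (ExteriorAlgebra.ιMulti ℤ m v) = (Matrix.of fun k l => v k (g l)).det := by
  rw [thetaCoeff, ExteriorAlgebra.liftAlternating_apply_ιMulti, Pi.single_eq_same]
  rfl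

theorem thetaCoeff_ιMulti_of_ne {N m m' : ℕ} (h : m' ≠ m) (g : Fin m → Fin N)
    (v : Fin m' → Fin N → ℤ) : thetaCoeff g (ExteriorAlgebra.ιMulti ℤ m' v) = 0 := by
  rw [thetaCoeff, ExteriorAlgebra.liftAlternating_apply_ιMulti, Pi.single_eq_of_ne h]
  rfl

/-- One statement serves both the group action (`h` an inverse permutation) and the truncation of
variables (`h = Fin.castSucc`). -/
theorem thetaCoeff_map {N N' m : ℕ} (g : Fin m → Fin N) (h : Fin N → Fin N')
    (w : ExteriorAlgebra ℤ (Fin N' → ℤ)) :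
    thetaCoeff g (ExteriorAlgebra.map (LinearMap.funLeft ℤ ℤ h) w) = thetaCoeff (h ∘ g) w := by
  suffices (thetaCoeff g).comp (ExteriorAlgebra.map (LinearMap.funLeft ℤ ℤ h)).toLinearMap =
    thetaCoeff (h ∘ g) from LinearMap.congr_fun this w
  refine ExteriorAlgebra.lhom_ext fun i => AlternatingMap.ext fun v => ?_
  simp only [LinearMap.compAlternatingMap_apply, LinearMap.comp_apply, AlgHom.toLinearMap_apply,
    ExteriorAlgebra.map_apply_ιMulti]
  by_cases hi : i = m
  · subst hi
    rw [thetaCoeff_ιMulti, thetaCoeff_ιMulti]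
    rfl
  · rw [thetaCoeff_ιMulti_of_ne hi, thetaCoeff_ιMulti_of_ne hi]

theorem thetaCoeff_comp_perm {N m : ℕ} (g : Fin m → Fin N) (τ : Equiv.Perm (Fin m))
    (w : ExteriorAlgebra ℤ (Fin N → ℤ)) :
    thetaCoeff (g ∘ τ) w = (Equiv.Perm.sign τ : ℤ) * thetaCoeff g w := by
  suffices thetaCoeff (g ∘ τ) = (Equiv.Perm.sign τ : ℤ) • thetaCoeff g by rw [this]; rfl
  refine ExteriorAlgebra.lhom_ext fun i => AlternatingMap.ext fun v => ?_
  simp only [LinearMap.compAlternatingMap_apply, LinearMap.smul_apply, smul_eq_mul]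
  by_cases hi : i = m
  · subst hi
    rw [thetaCoeff_ιMulti, thetaCoeff_ιMulti]
    exact Matrix.det_permute' τ (Matrix.of fun k l => v k (g l))
  · rw [thetaCoeff_ιMulti_of_ne hi, thetaCoeff_ιMulti_of_ne hi, mul_zero]

theorem thetaCoeff_of_not_injective {N m : ℕ} {g : Fin m → Fin N} (hg : ¬ Function.Injective g) :
    thetaCoeff g = 0 := by
  refine ExteriorAlgebra.lhom_ext fun i => AlternatingMap.ext fun v => ?_
  simp only [LinearMap.compAlternatingMap_apply, LinearMap.zero_apply]
  by_cases hi : i = m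
  · subst hi
    simp only [Function.Injective, not_forall] at hg
    obtain ⟨a, b, hab, hne⟩ := hg
    rw [thetaCoeff_ιMulti]
    exact Matrix.det_zero_of_column_eq hne fun k => by simp [hab]
  · rw [thetaCoeff_ιMulti_of_ne hi]

theorem thetaCoeff_of_mem {N m m' : ℕ} (h : m' ≠ m) (g : Fin m → Fin N)
    {w : ExteriorAlgebra ℤ (Fin N → ℤ)} (hw : w ∈ ⋀[ℤ]^m' (Fin N → ℤ)) : thetaCoeff g w = 0 := by
  rw [← ExteriorAlgebra.ιMulti_span_fixedDegree] at hw
  induction hw using Submodule.span_induction with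
  | mem x hx => obtain ⟨v, rfl⟩ := hx; exact thetaCoeff_ιMulti_of_ne h g v
  | zero => exact map_zero _
  | add x y _ _ hx hy => rw [map_add, hx, hy, add_zero]
  | smul a x _ hx => rw [map_smul, hx, smul_zero]

/-- The product `θ_{g 0} θ_{g 1} ⋯`. -/
abbrev thetaMul {N m : ℕ} (g : Fin m → Fin N) : ExteriorAlgebra ℤ (Fin N → ℤ) :=
  ExteriorAlgebra.ιMulti ℤ m fun k => Pi.single (g k) (1 : ℤ)

theorem thetaCoeff_thetaMul_self {N m : ℕ} {g : Fin m → Fin N} (hg : Function.Injective g) :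
    thetaCoeff g (thetaMul g) = 1 := by
  rw [thetaMul, thetaCoeff_ιMulti]
  convert Matrix.det_one (n := Fin m) (R := ℤ) using 2
  ext k l
  rw [Matrix.of_apply, Matrix.one_apply, Pi.single_apply]
  exact if_congr (by rw [hg.eq_iff, eq_comm]) rfl rfl

theorem exists_of_thetaCoeff_thetaMul_ne_zero {N m : ℕ} {g j : Fin m → Fin N}
    (h : thetaCoeff g (thetaMul j) ≠ 0) : ∀ k, ∃ l, j k = g l := by
  intro k
  by_contra hk
  push Not at hk
  rw [thetaMul, thetaCoeff_ιMulti] at h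
  refine h (Matrix.det_eq_zero_of_row_eq_zero k fun l => ?_)
  rw [Matrix.of_apply, Pi.single_eq_of_ne (hk l).symm]

theorem map_thetaMul {N m : ℕ} (σ : Equiv.Perm (Fin N)) (g : Fin m → Fin N) :
    ExteriorAlgebra.map (LinearMap.funLeft ℤ ℤ σ.symm) (thetaMul g) = thetaMul (σ ∘ g) := by
  rw [thetaMul, ExteriorAlgebra.map_apply_ιMulti]
  congr 1
  funext k j
  simp only [Function.comp_apply, LinearMap.funLeft_apply, Pi.single_apply]
  exact if_congr (by rw [Equiv.symm_apply_eq]) rfl rfl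

theorem thetaMul_mem {N m : ℕ} (g : Fin m → Fin N) : thetaMul g ∈ ⋀[ℤ]^m (Fin N → ℤ) := by
  rw [← ExteriorAlgebra.ιMulti_span_fixedDegree]
  exact Submodule.subset_span ⟨_, rfl⟩

/-- The coefficient of `x^α θ_{g 0} θ_{g 1} ⋯` in a superpolynomial. -/
def superCoeff {N m : ℕ} (α : Fin N →₀ ℕ) (g : Fin m → Fin N) : SuperPoly N →ₗ[ℤ] ℤ :=
  (TensorProduct.lid ℤ ℤ).toLinearMap ∘ₗ TensorProduct.map (MvPolynomial.lcoeff ℤ α) (thetaCoeff g)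

theorem superCoeff_tmul {N m : ℕ} (α : Fin N →₀ ℕ) (g : Fin m → Fin N)
    (p : MvPolynomial (Fin N) ℤ) (w : ExteriorAlgebra ℤ (Fin N → ℤ)) :
    superCoeff α g (p ⊗ₜ w) = p.coeff α * thetaCoeff g w := rfl

theorem superCoeff_of_not_injective {N m : ℕ} (α : Fin N →₀ ℕ) {g : Fin m → Fin N}
    (hg : ¬ Function.Injective g) (f : SuperPoly N) : superCoeff α g f = 0 := by
  induction f using TensorProduct.induction_on with
  | zero => exact map_zero _
  | tmul p w => rw [superCoeff_tmul, thetaCoeff_of_not_injective hg, LinearMap.zero_apply, mul_zero]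
  | add x y hx hy => rw [map_add, hx, hy, add_zero]

theorem superCoeff_comp_perm {N m : ℕ} (α : Fin N →₀ ℕ) (g : Fin m → Fin N)
    (τ : Equiv.Perm (Fin m)) (f : SuperPoly N) :
    superCoeff α (g ∘ τ) f = (Equiv.Perm.sign τ : ℤ) * superCoeff α g f := by
  induction f using TensorProduct.induction_on with
  | zero => simp
  | tmul p w => rw [superCoeff_tmul, superCoeff_tmul, thetaCoeff_comp_perm]; ring
  | add x y hx hy => rw [map_add, map_add, hx, hy, mul_add]

theorem superCoeff_permAct {N m : ℕ} (α : Fin N →₀ ℕ) (g : Fin m → Fin N)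
    (σ : Equiv.Perm (Fin N)) (f : SuperPoly N) :
    superCoeff (α.mapDomain σ) (σ ∘ g) (permAct σ f) = superCoeff α g f := by
  induction f using TensorProduct.induction_on with
  | zero => simp
  | tmul p w =>
    rw [permAct, Algebra.TensorProduct.map_tmul, superCoeff_tmul, superCoeff_tmul,
      MvPolynomial.coeff_rename_mapDomain _ σ.injective, thetaCoeff_map, ← Function.comp_assoc,
      Equiv.symm_comp_self, Function.id_comp]
  | add x y hx hy => rw [map_add, map_add, map_add, hx, hy]

/-- Only monomials free of the last variable survive, and these are the ones with exponent vectors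
extended by zero. -/
theorem coeff_aeval_lastCases {N : ℕ} (α : Fin N →₀ ℕ) (p : MvPolynomial (Fin (N + 1)) ℤ) :
    (MvPolynomial.aeval (Fin.lastCases (0 : MvPolynomial (Fin N) ℤ)
      fun i : Fin N => MvPolynomial.X i) p).coeff α = p.coeff (α.mapDomain Fin.castSucc) := by
  have hcs : ∀ i : Fin N, (α.mapDomain Fin.castSucc) i.castSucc = α i := fun i =>
    Finsupp.mapDomain_apply (Fin.castSucc_injective N) _ _
  have hlast : (α.mapDomain Fin.castSucc) (Fin.last N) = 0 :=
    Finsupp.mapDomain_of_notMem_range _ _ (by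
      rintro ⟨i, hi⟩
      exact (Fin.castSucc_lt_last i).ne hi)
  induction p using MvPolynomial.induction_on' with
  | add p q hp hq => rw [map_add, MvPolynomial.coeff_add, MvPolynomial.coeff_add, hp, hq]
  | monomial s a =>
    rw [MvPolynomial.aeval_monomial, Finsupp.prod_fintype _ _ (fun i => pow_zero _),
      Fin.prod_univ_castSucc]
    simp only [Fin.lastCases_castSucc, Fin.lastCases_last, MvPolynomial.algebraMap_eq,
      MvPolynomial.coeff_monomial]
    by_cases h0 : s (Fin.last N) = 0
    · rw [h0, pow_zero, mul_one]
      have : (∏ i : Fin N, (MvPolynomial.X i : MvPolynomial (Fin N) ℤ) ^ s i.castSucc) =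
          MvPolynomial.monomial (Finsupp.equivFunOnFinite.symm fun i => s i.castSucc) 1 := by
        rw [MvPolynomial.monomial_eq, Finsupp.prod_fintype _ _ (fun i => pow_zero _)]
        simp
      rw [this, MvPolynomial.C_mul_monomial, mul_one, MvPolynomial.coeff_monomial]
      refine if_congr ⟨?_, fun h => ?_⟩ rfl rfl
      · rintro h
        ext i
        refine Fin.lastCases ?_ (fun i => ?_) i
        · rw [h0, hlast]
        · rw [hcs, ← h]; rfl
      · ext i
        rw [← hcs, ← h]; rfl
    · rw [zero_pow h0, mul_zero, mul_zero, MvPolynomial.coeff_zero, if_neg]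
      rintro rfl
      exact h0 hlast

theorem superCoeff_restrictSuper {N m : ℕ} (α : Fin N →₀ ℕ) (g : Fin m → Fin N)
    (f : SuperPoly (N + 1)) :
    superCoeff α g (restrictSuper N f) =
      superCoeff (α.mapDomain Fin.castSucc) (Fin.castSucc ∘ g) f := by
  induction f using TensorProduct.induction_on with
  | zero => simp
  | tmul p w =>
    rw [restrictSuper, Algebra.TensorProduct.map_tmul, superCoeff_tmul, superCoeff_tmul,
      thetaCoeff_map, coeff_aeval_lastCases]
  | add x y hx hy => rw [map_add, map_add, map_add, hx, hy]

theorem superCoeff_ne_zero_of_homog {N n m m' : ℕ} {α : Fin N →₀ ℕ} {g : Fin m' → Fin N}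
    {f : SuperPoly N} (hf : f ∈ homogSuperPoly N n m) (h : superCoeff α g f ≠ 0) :
    α.degree = n ∧ m' = m := by
  contrapose! h
  rw [homogSuperPoly] at hf
  induction hf using Submodule.span_induction with
  | mem x hx =>
    obtain ⟨p, w, hp, hw, rfl⟩ := hx
    rw [superCoeff_tmul]
    by_cases hα : α.degree = n
    · rw [thetaCoeff_of_mem (h hα).symm g hw, mul_zero]
    · rw [hp.coeff_eq_zero hα, zero_mul]
  | zero => exact map_zero _
  | add x y _ _ hx hy => rw [map_add, hx, hy, add_zero]
  | smul a x _ hx => rw [map_smul, hx, smul_zero]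

/-- The basis of the superpolynomials formed by the monomials `x^α θ_K`. -/
def superBasis (N : ℕ) : Module.Basis ((Fin N →₀ ℕ) × Finset (Fin N)) ℤ (SuperPoly N) :=
  (MvPolynomial.basisMonomials (Fin N) ℤ).tensorProduct (Pi.basisFun ℤ (Fin N)).ExteriorAlgebra

theorem superBasis_apply {N : ℕ} (α : Fin N →₀ ℕ) (K : Finset (Fin N)) :
    superBasis N (α, K) = MvPolynomial.monomial α 1 ⊗ₜ thetaMul (K.orderEmbOfFin rfl) := by
  refine (Module.Basis.tensorProduct_apply (MvPolynomial.basisMonomials (Fin N) ℤ)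
    (Pi.basisFun ℤ (Fin N)).ExteriorAlgebra α K).trans ?_
  rw [MvPolynomial.coe_basisMonomials]
  congr 1
  rw [ExteriorAlgebra.basis_apply_ofCard _ rfl]
  simp only [ExteriorAlgebra.ιMulti_family, thetaMul]
  congr 1
  funext k
  simp only [Function.comp_apply, Pi.basisFun_apply]
  rfl

/-- For index sets of equal size, a nonzero determinant forces one set into the other, hence
equality; sets of different size are separated by degree. -/
theorem superBasis_coord {N : ℕ} (α : Fin N →₀ ℕ) (K : Finset (Fin N)) :
    (superBasis N).coord (α, K) = superCoeff α (K.orderEmbOfFin rfl) := by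
  refine (superBasis N).ext ?_
  rintro ⟨β, L⟩
  rw [Module.Basis.coord_apply, Module.Basis.repr_self, superBasis_apply, superCoeff_tmul,
    MvPolynomial.coeff_monomial, Finsupp.single_apply]
  by_cases hL : L = K
  · subst hL
    rw [thetaCoeff_thetaMul_self (L.orderEmbOfFin rfl).injective, mul_one]
    exact if_congr (by simp) rfl rfl
  · rw [if_neg (by simp [hL])]
    symm
    apply mul_eq_zero_of_right
    by_cases hc : L.card = K.card
    · by_contra hne
      refine hL (Finset.eq_of_subset_of_card_le (fun i hi => ?_) hc.ge)
      have hL' : thetaMul (L.orderEmbOfFin rfl) = thetaMul (L.orderEmbOfFin hc) := by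
        have : ∀ (c : ℕ) (h : L.card = c), thetaMul (L.orderEmbOfFin rfl) =
          thetaMul (L.orderEmbOfFin h) := by rintro _ rfl; rfl
        exact this _ hc
      rw [hL'] at hne
      obtain ⟨k, rfl⟩ : ∃ k, L.orderEmbOfFin hc k = i := by
        have := Finset.range_orderEmbOfFin L hc
        rw [Set.ext_iff] at this
        exact (this i).2 hi
      obtain ⟨l, hl⟩ := exists_of_thetaCoeff_thetaMul_ne_zero hne k
      rw [hl]
      exact Finset.orderEmbOfFin_mem K rfl l
    · exact thetaCoeff_ιMulti_of_ne hc _ _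

theorem superPoly_eq_zero_of_superCoeff {N : ℕ} {f : SuperPoly N}
    (h : ∀ (m : ℕ) (α : Fin N →₀ ℕ) (g : Fin m → Fin N), superCoeff α g f = 0) : f = 0 := by
  refine (superBasis N).ext_elem fun ⟨α, K⟩ => ?_
  rw [← Module.Basis.coord_apply, superBasis_coord, h]
  simp

end

/-! ### Leading terms and the supermonomials -/

theorem lt_apply_iff_of_antitone {N : ℕ} {f : Fin N → ℕ} (hf : Antitone f) (v : ℕ) (p : Fin N) :
    v < f p ↔ (p : ℕ) < (Finset.univ.filter fun q => v < f q).card := by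
  have hs : (List.ofFn f).Pairwise (· ≥ ·) := by
    rw [List.pairwise_ofFn]
    exact fun i j hij => hf hij.le
  have h := lt_getD_iff_of_sorted hs v p
  rw [List.getD_eq_getElem _ _ (by simp), List.getElem_ofFn] at h
  rw [h]
  have : (Finset.univ.filter fun q => v < f q).card = ((List.ofFn f).filter (v < ·)).length := by
    rw [List.ofFn_eq_map, List.filter_map, List.length_map]
    rfl
  rw [this]

theorem card_filter_fin {N : ℕ} (P : ℕ → Prop) [DecidablePred P] :
    (Finset.univ.filter fun j : Fin N => P j).card = ((Finset.range N).filter P).card := by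
  rw [Finset.card_filter, Finset.card_filter,
    Fin.sum_univ_eq_sum_range (fun j => if P j then 1 else 0)]

noncomputable section

namespace SPar

variable {n m : ℕ}

/-- The exponent vector of the leading term `x^Λ` in `N` variables. -/
def exponent (Λ : SPar n m) (N : ℕ) : Fin N →₀ ℕ :=
  Finsupp.equivFunOnFinite.symm fun i : Fin N => compEntry Λ.toComp i

theorem exponent_apply (Λ : SPar n m) {N : ℕ} (i : Fin N) :
    Λ.exponent N i = compEntry Λ.toComp i := rfl

theorem numGT_eq_card (Λ : SPar n m) {N : ℕ} (h : Λ.length ≤ N) (v : ℕ) :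
    Λ.numGT v = (Finset.univ.filter fun j : Fin N => v < Λ.exponent N j).card := by
  rw [← length_filter_toComp, ← card_filter_lt_compEntry _ v N (by rwa [length_toComp])]
  exact (card_filter_fin fun j => v < compEntry Λ.toComp j).symm

theorem sortedEntry_eq_of_numGT {Ω Γ : SPar n m} (h : Ω.numGT = Γ.numGT) :
    Ω.sortedEntry = Γ.sortedEntry := funext fun p => eq_of_forall_lt_iff fun v => by
  rw [lt_sortedEntry, lt_sortedEntry, h]

theorem le_length (Λ : SPar n m) : m ≤ Λ.length := Nat.le_add_right _ _

theorem anti_eq_image (Λ : SPar n m) {N : ℕ} (h : m ≤ N) :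
    Λ.anti = Finset.univ.image fun k : Fin m => Λ.exponent N (Fin.castLE h k) := by
  ext b
  simp only [Finset.mem_image, Finset.mem_univ, true_and, exponent_apply, Fin.val_castLE]
  constructor
  · intro hb
    obtain ⟨i, hi, h⟩ := Λ.exists_compEntry_toComp hb
    exact ⟨⟨i, hi⟩, h⟩
  · rintro ⟨k, rfl⟩
    exact Λ.compEntry_toComp_mem k.2

theorem strictAnti_exponent (Λ : SPar n m) {N : ℕ} (h : m ≤ N) :
    StrictAnti fun k : Fin m => Λ.exponent N (Fin.castLE h k) :=
  fun _ l hkl => Λ.compEntry_toComp_lt hkl l.2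

/-- The coefficient of the leading term `θ₁ ⋯ θ_m x^Λ`. -/
def leadCoeff (Λ : SPar n m) {N : ℕ} (h : m ≤ N) : SuperPoly N →ₗ[ℤ] ℤ :=
  superCoeff (Λ.exponent N) (Fin.castLE h)

end SPar

theorem leadingTerm_eq {n m : ℕ} (Λ : SPar n m) {N : ℕ} (h : m ≤ N) :
    leadingTerm Λ N h = MvPolynomial.monomial (Λ.exponent N) 1 ⊗ₜ thetaMul (Fin.castLE h) := rfl

theorem permAct_leadingTerm {n m : ℕ} (Λ : SPar n m) {N : ℕ} (h : m ≤ N)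
    (σ : Equiv.Perm (Fin N)) :
    permAct σ (leadingTerm Λ N h) =
      MvPolynomial.monomial ((Λ.exponent N).mapDomain σ) 1 ⊗ₜ thetaMul (σ ∘ Fin.castLE h) := by
  rw [leadingTerm_eq, permAct, Algebra.TensorProduct.map_tmul, map_thetaMul,
    MvPolynomial.rename_monomial]

theorem leadCoeff_leadingTerm {n m : ℕ} (Λ : SPar n m) {N : ℕ} (h : m ≤ N) :
    Λ.leadCoeff h (leadingTerm Λ N h) = 1 := by
  rw [SPar.leadCoeff, leadingTerm_eq, superCoeff_tmul,
    thetaCoeff_thetaMul_self (Fin.castLE_injective h)]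
  simp

/-- The largest index can only be fixed, and injectivity propagates this downwards. -/
theorem Fin.eq_id_of_le_apply {m : ℕ} {τ : Fin m → Fin m} (hτ : Function.Injective τ)
    (h : ∀ i, i ≤ τ i) : τ = id := by
  have key : ∀ d : ℕ, ∀ i : Fin m, m - 1 - i = d → τ i = i := by
    intro d
    induction d using Nat.strong_induction_on with
    | _ d ih =>
      intro i hi
      by_contra hne
      have hlt : i < τ i := lt_of_le_of_ne (h i) (Ne.symm hne)
      have := ih (m - 1 - (τ i : ℕ)) (by have := (τ i).2; have : (i : ℕ) < τ i := hlt; omega)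
        (τ i) rfl
      exact hne (hτ this)
  exact funext fun i => key _ i rfl

/-- `σ` must preserve the first `m` positions, and it fixes each of them since the exponents
decrease strictly there for both superpartitions. So no sign can appear, and only one of the
distinct terms contributes. -/
theorem leadingTerm_of_leadCoeff_ne_zero {n m : ℕ} {Ω Γ : SPar n m} {N : ℕ} (hΩ : Ω.length ≤ N)
    (hΓ : Γ.length ≤ N) (h : m ≤ N) (σ : Equiv.Perm (Fin N))
    (hne : Γ.leadCoeff h (permAct σ (leadingTerm Ω N h)) ≠ 0) :
    Γ = Ω ∧ permAct σ (leadingTerm Ω N h) = leadingTerm Ω N h := by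
  rw [permAct_leadingTerm] at hne ⊢
  rw [SPar.leadCoeff, superCoeff_tmul] at hne
  have h1 : (Ω.exponent N).mapDomain σ = Γ.exponent N := by
    by_contra h'
    rw [MvPolynomial.coeff_monomial, if_neg h', zero_mul] at hne
    exact hne rfl
  have h1' : ∀ j, Γ.exponent N (σ j) = Ω.exponent N j := fun j => by
    rw [← h1, Finsupp.mapDomain_apply σ.injective]
  choose τ hτ using exists_of_thetaCoeff_thetaMul_ne_zero (right_ne_zero_of_mul hne)
  have hτinj : Function.Injective τ := fun a b hab => by
    have : σ (Fin.castLE h a) = σ (Fin.castLE h b) := (hτ a).trans (hab ▸ (hτ b).symm)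
    exact Fin.castLE_injective h (σ.injective this)
  have hτmono : StrictMono τ := by
    intro a b hab
    rw [← (Γ.strictAnti_exponent h).lt_iff_gt]
    simp only [← hτ, Function.comp_apply, h1']
    exact Ω.strictAnti_exponent h hab
  have hτid : τ = id := Fin.eq_id_of_le_apply hτinj fun i => hτmono.le_apply
  have hfix : σ ∘ Fin.castLE h = Fin.castLE h := funext fun k => by
    rw [hτ, hτid, id]
  have hEq : Γ = Ω := by
    refine SPar.ext_of_sortedEntry (SPar.sortedEntry_eq_of_numGT (funext fun v => ?_)) ?_
    · rw [Γ.numGT_eq_card hΓ, Ω.numGT_eq_card hΩ]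
      symm
      refine Finset.card_equiv σ fun i => ?_
      simp [h1']
    · rw [Γ.anti_eq_image h, Ω.anti_eq_image h]
      congr 1
      funext k
      rw [← h1', ← Function.comp_apply (f := σ), hfix]
  subst hEq
  exact ⟨rfl, by rw [h1, hfix, leadingTerm_eq]⟩

theorem leadCoeff_superMonomialN {n m : ℕ} (Ω Γ : SPar n m) {N : ℕ} (hΓ : Γ.length ≤ N)
    (h : m ≤ N) [Decidable (Γ = Ω)] :
    Γ.leadCoeff h (superMonomialN Ω N) = if Γ = Ω then 1 else 0 := by
  classical
  rw [superMonomialN]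
  split_ifs with hΩ hEq hEq
  · subst hEq
    rw [map_sum, Finset.sum_eq_single (leadingTerm Γ N h), leadCoeff_leadingTerm]
    · intro t ht hne
      by_contra h'
      obtain ⟨σ, -, rfl⟩ := Finset.mem_image.1 ht
      exact hne (leadingTerm_of_leadCoeff_ne_zero hΩ hΓ h σ h').2
    · intro h'
      refine absurd (Finset.mem_image.2 ⟨1, Finset.mem_univ _, ?_⟩) h'
      rw [permAct_leadingTerm, leadingTerm_eq]
      simp
  · rw [map_sum]
    refine Finset.sum_eq_zero fun t ht => ?_
    by_contra h'
    obtain ⟨σ, -, rfl⟩ := Finset.mem_image.1 ht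
    exact hEq (leadingTerm_of_leadCoeff_ne_zero hΩ hΓ h σ h').1
  · exact absurd (hEq ▸ hΓ) hΩ
  · exact map_zero _

theorem permAct_mul {N : ℕ} (σ τ : Equiv.Perm (Fin N)) (f : SuperPoly N) :
    permAct (σ * τ) f = permAct σ (permAct τ f) := by
  suffices permAct (σ * τ) = (permAct σ).comp (permAct τ) by rw [this]; rfl
  rw [permAct, permAct, permAct, ← Algebra.TensorProduct.map_comp]
  congr 1
  · ext i; simp
  · refine ExteriorAlgebra.hom_ext (LinearMap.ext fun v => ?_)
    simp only [LinearMap.comp_apply, AlgHom.toLinearMap_apply, AlgHom.comp_apply,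
      ExteriorAlgebra.map_apply_ι]
    rfl

theorem superMonomialN_mem_symm {n m : ℕ} (Ω : SPar n m) (N : ℕ) :
    superMonomialN Ω N ∈ SymSuperPoly N := by
  classical
  intro σ
  rw [superMonomialN]
  split_ifs with h
  · rw [map_sum]
    have hinv : ∀ (ρ : Equiv.Perm (Fin N)) (f : SuperPoly N), permAct ρ⁻¹ (permAct ρ f) = f := by
      intro ρ f
      rw [← permAct_mul, inv_mul_cancel, permAct, Equiv.Perm.one_def]
      have : LinearMap.funLeft ℤ ℤ (Equiv.refl (Fin N)).symm = LinearMap.id := rfl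
      rw [this, ExteriorAlgebra.map_id]
      have h2 : MvPolynomial.rename (R := ℤ) (Equiv.refl (Fin N)) = AlgHom.id ℤ _ := by
        ext i; simp
      rw [h2, Algebra.TensorProduct.map_id]
      rfl
    refine Finset.sum_nbij' (permAct σ) (permAct σ⁻¹) ?_ ?_ ?_ ?_ ?_
    · intro t ht
      obtain ⟨ρ, -, rfl⟩ := Finset.mem_image.1 ht
      exact Finset.mem_image.2 ⟨σ * ρ, Finset.mem_univ _, permAct_mul _ _ _⟩
    · intro t ht
      obtain ⟨ρ, -, rfl⟩ := Finset.mem_image.1 ht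
      exact Finset.mem_image.2 ⟨σ⁻¹ * ρ, Finset.mem_univ _, permAct_mul _ _ _⟩
    · exact fun t _ => hinv σ t
    · intro t _
      simpa using hinv σ⁻¹ t
    · exact fun _ _ => rfl
  · exact map_zero _

theorem degree_exponent {n m : ℕ} (Ω : SPar n m) {N : ℕ} (h : Ω.length ≤ N) :
    (Ω.exponent N).degree = n := by
  have h1 : ∀ (c : List ℕ) (K : ℕ), c.length ≤ K →
      ∑ j ∈ Finset.range K, compEntry c j = c.sum := by
    intro c
    induction c with
    | nil => simp [compEntry]
    | cons a c ih =>
      intro K hK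
      obtain ⟨K, rfl⟩ : ∃ K', K = K' + 1 := ⟨K - 1, by simp at hK; omega⟩
      rw [Finset.sum_range_succ', List.sum_cons, ← ih K (by simpa using hK), add_comm]
      rfl
  rw [Finsupp.degree_eq_sum]
  simp only [SPar.exponent_apply]
  rw [Fin.sum_univ_eq_sum_range (compEntry Ω.toComp), h1 _ _ (by rwa [SPar.length_toComp]),
    ← Multiset.sum_coe, SPar.coe_toComp, SPar.sum_parts]

theorem superMonomialN_mem_homog {n m : ℕ} (Ω : SPar n m) (N : ℕ) :
    superMonomialN Ω N ∈ homogSuperPoly N n m := by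
  classical
  rw [superMonomialN]
  split_ifs with h
  · refine Submodule.sum_mem _ fun t ht => ?_
    obtain ⟨σ, -, rfl⟩ := Finset.mem_image.1 ht
    rw [permAct_leadingTerm]
    refine Submodule.subset_span ⟨_, _, MvPolynomial.isHomogeneous_monomial _ ?_,
      thetaMul_mem _, rfl⟩
    rw [Finsupp.degree_mapDomain, degree_exponent _ h]
  · exact zero_mem _

end

/-! ### Leading coefficients determine a symmetric superpolynomial -/

theorem eq_of_strictAnti_of_antitone {N m : ℕ} {f f' : Fin N → ℕ}
    (hf : ∀ i j : Fin N, i < j → (j : ℕ) < m → f j < f i)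
    (hf' : ∀ i j : Fin N, i < j → (j : ℕ) < m → f' j < f' i)
    (hg : ∀ i j : Fin N, m ≤ (i : ℕ) → i ≤ j → f j ≤ f i)
    (hg' : ∀ i j : Fin N, m ≤ (i : ℕ) → i ≤ j → f' j ≤ f' i)
    (himg : (Finset.univ.filter fun i : Fin N => (i : ℕ) < m).image f =
      (Finset.univ.filter fun i : Fin N => (i : ℕ) < m).image f')
    (hcard : ∀ v, (Finset.univ.filter fun j => v < f j).card =
      (Finset.univ.filter fun j => v < f' j).card) : f = f' := by
  -- in both regions, an entry is determined by the number of larger entries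
  have hinj : ∀ h : Fin N → ℕ, (∀ i j : Fin N, i < j → (j : ℕ) < m → h j < h i) →
      Set.InjOn h (Finset.univ.filter fun i : Fin N => (i : ℕ) < m) := by
    intro h hh i hi j hj hij
    simp only [Finset.coe_filter, Finset.mem_univ, true_and, Set.mem_ofPred_eq] at hi hj
    rcases lt_trichotomy i j with hlt | heq | hlt
    · exact absurd hij (hh _ _ hlt hj).ne'
    · exact heq
    · exact absurd hij (hh _ _ hlt hi).ne
  have hfirst : ∀ v, ((Finset.univ.filter fun i : Fin N => (i : ℕ) < m).filter
      fun i => v < f i).card = ((Finset.univ.filter fun i : Fin N => (i : ℕ) < m).filter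
      fun i => v < f' i).card := by
    intro v
    have key : ∀ h : Fin N → ℕ, (∀ i j : Fin N, i < j → (j : ℕ) < m → h j < h i) →
        ((Finset.univ.filter fun i : Fin N => (i : ℕ) < m).filter fun i => v < h i).card =
        (((Finset.univ.filter fun i : Fin N => (i : ℕ) < m).image h).filter (v < ·)).card := by
      intro h hh
      rw [Finset.filter_image, Finset.card_image_of_injOn]
      exact (hinj h hh).mono (by
        intro i hi
        exact Finset.mem_coe.2 (Finset.mem_filter.1 (Finset.mem_coe.1 hi)).1)
    rw [key f hf, key f' hf', himg]
  have hsplit : ∀ (h : Fin N → ℕ) (v : ℕ), (Finset.univ.filter fun j => v < h j).card =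
      ((Finset.univ.filter fun i : Fin N => (i : ℕ) < m).filter fun i => v < h i).card +
      (Finset.univ.filter fun i : Fin N => v < h i ∧ ¬ (i : ℕ) < m).card := by
    intro h v
    rw [← Finset.card_filter_add_card_filter_not (s := Finset.univ.filter fun j => v < h j)
      (fun i : Fin N => (i : ℕ) < m), Finset.filter_filter, Finset.filter_filter,
      Finset.filter_filter]
    congr 2
    ext i
    simp [and_comm]
  have hsecond : ∀ v, (Finset.univ.filter fun i : Fin N => v < f i ∧ ¬ (i : ℕ) < m).card =
      (Finset.univ.filter fun i : Fin N => v < f' i ∧ ¬ (i : ℕ) < m).card := by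
    intro v
    have h1 := hsplit f v
    have h2 := hsplit f' v
    have h3 := hfirst v
    have h4 := hcard v
    omega
  funext i
  refine eq_of_forall_lt_iff fun v => ?_
  rcases lt_or_ge (i : ℕ) m with him | him
  · have key : ∀ h : Fin N → ℕ, (∀ i j : Fin N, i < j → (j : ℕ) < m → h j < h i) →
        (v < h i ↔ (i : ℕ) < ((Finset.univ.filter fun i : Fin N => (i : ℕ) < m).filter
          fun i => v < h i).card) := by
      intro h hh
      -- Padding by zero adds no entry above `v`.
      have hanti : Antitone fun j : Fin N => if (j : ℕ) < m then h j else 0 := by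
        intro a b hab
        have hab' : (a : ℕ) ≤ b := hab
        rcases hab.eq_or_lt with rfl | hlt
        · exact le_rfl
        · dsimp only
          split_ifs with hb ha
          · exact (hh _ _ hlt hb).le
          · omega
          · exact Nat.zero_le _
          · exact le_rfl
      have := lt_apply_iff_of_antitone hanti v i
      rw [if_pos him] at this
      rw [this]
      have hset : (Finset.univ.filter fun q : Fin N => v < if (q : ℕ) < m then h q else 0) =
          (Finset.univ.filter fun i : Fin N => (i : ℕ) < m).filter fun i => v < h i := by
        ext q
        simp only [Finset.mem_filter, Finset.mem_univ, true_and]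
        split_ifs with hq <;> simp [hq]
      rw [hset]
    rw [key f hf, key f' hf', hfirst]
  · have key : ∀ h : Fin N → ℕ, (∀ i j : Fin N, m ≤ (i : ℕ) → i ≤ j → h j ≤ h i) →
        (v < h i ↔ (i : ℕ) < (Finset.univ.filter fun i : Fin N => (i : ℕ) < m).card +
          (Finset.univ.filter fun i : Fin N => v < h i ∧ ¬ (i : ℕ) < m).card) := by
      intro h hh
      -- Filling the first block with a value above `v` and above all entries keeps the sequence
      -- antitone and shifts the count by the size of the block.
      obtain ⟨M, hM, hM'⟩ : ∃ M, v < M ∧ ∀ j, h j ≤ M := by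
        refine ⟨v + 1 + ∑ j, h j, by omega, fun j => ?_⟩
        have := Finset.single_le_sum (f := h) (fun _ _ => Nat.zero_le _) (Finset.mem_univ j)
        omega
      have hanti : Antitone fun j : Fin N => if (j : ℕ) < m then M else h j := by
        intro a b hab
        have hab' : (a : ℕ) ≤ b := hab
        dsimp only
        split_ifs with hb ha ha
        · exact le_rfl
        · omega
        · exact hM' b
        · exact hh _ _ (not_lt.1 ha) hab
      have := lt_apply_iff_of_antitone hanti v i
      rw [if_neg (not_lt.2 him)] at this
      rw [this, ← Finset.card_union_of_disjoint]
      · have hset : (Finset.univ.filter fun q : Fin N => v < if (q : ℕ) < m then M else h q) =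
            (Finset.univ.filter fun i : Fin N => (i : ℕ) < m) ∪
            (Finset.univ.filter fun i : Fin N => v < h i ∧ ¬ (i : ℕ) < m) := by
          ext q
          simp only [Finset.mem_filter, Finset.mem_univ, true_and, Finset.mem_union]
          split_ifs with hq <;> simp [hq, hM]
        rw [hset]
      · rw [Finset.disjoint_left]
        intro q hq hq'
        exact (Finset.mem_filter.1 hq').2.2 (Finset.mem_filter.1 hq).2
    rw [key f hg, key f' hg', hsecond]

noncomputable section

theorem SPar.exists_exponent_eq {N m : ℕ} (h : m ≤ N) (β : Fin N →₀ ℕ)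
    (hβ : ∀ i j : Fin N, i < j → (j : ℕ) < m → β j < β i)
    (hβ' : ∀ i j : Fin N, m ≤ (i : ℕ) → i ≤ j → β j ≤ β i) :
    ∃ Λ : SPar β.degree m, Λ.length ≤ N ∧ Λ.exponent N = β := by
  set A := Finset.univ.filter fun i : Fin N => (i : ℕ) < m with hA
  set B := Finset.univ.filter fun i : Fin N => ¬ (i : ℕ) < m with hB
  have hinj : Set.InjOn β A := by
    intro i hi j hj hij
    simp only [hA, Finset.coe_filter, Finset.mem_univ, true_and, Set.mem_ofPred_eq] at hi hj
    rcases lt_trichotomy i j with hlt | heq | hlt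
    · exact absurd hij (hβ _ _ hlt hj).ne'
    · exact heq
    · exact absurd hij (hβ _ _ hlt hi).ne
  have hcardA : A.card = m := by rw [hA, Fin.card_filter_val_lt, min_eq_right h]
  have hcardAB : A.card + B.card = N := by
    have := Finset.card_filter_add_card_filter_not (s := (Finset.univ : Finset (Fin N)))
      (fun i : Fin N => (i : ℕ) < m)
    rwa [Finset.card_univ, Fintype.card_fin] at this
  have hval : (A.image β).val = A.val.map β := Finset.image_val_of_injOn hinj
  let Λ : SPar β.degree m :=
    { anti := A.image β
      symm := (B.val.map β).filter (0 < ·)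
      card_anti := by rw [Finset.card_image_of_injOn hinj, hcardA]
      symm_pos := fun h0 => by simpa using (Multiset.mem_filter.1 h0).2
      sum_eq := by
        rw [SPar.sum_filter_pos, hval, Finsupp.degree_eq_sum]
        exact Finset.sum_filter_add_sum_filter_not Finset.univ (fun i : Fin N => (i : ℕ) < m) β }
  have hlen : Λ.length ≤ N := by
    have : Λ.symm.card ≤ B.card := by
      refine (Multiset.card_le_card (Multiset.filter_le (0 < ·) (B.val.map β))).trans ?_
      rw [Multiset.card_map]; rfl
    rw [SPar.length]
    omega
  refine ⟨Λ, hlen, DFunLike.coe_injective (eq_of_strictAnti_of_antitone (m := m) ?_ hβ ?_ hβ' ?_ ?_)⟩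
  · exact fun i j hij hj => Λ.compEntry_toComp_lt hij hj
  · exact fun i j hi hij => Λ.compEntry_toComp_anti hi hij
  · have : A.image β = Λ.anti := rfl
    rw [← hA, this, Λ.anti_eq_image h]
    ext b
    simp only [hA, Finset.mem_image, Finset.mem_filter, Finset.mem_univ, true_and]
    constructor
    · rintro ⟨i, hi, rfl⟩
      exact ⟨⟨i, hi⟩, rfl⟩
    · rintro ⟨k, rfl⟩
      exact ⟨Fin.castLE h k, k.2, rfl⟩
  · intro v
    rw [← Λ.numGT_eq_card hlen]
    have hp : Λ.parts = A.val.map β + (B.val.map β).filter (0 < ·) := by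
      rw [← hval]; rfl
    rw [SPar.numGT, hp, Multiset.filter_add, Multiset.filter_filter, Multiset.filter_congr
      (p := fun a => v < a ∧ 0 < a) (q := (v < ·)) fun a _ => ⟨fun h => h.1, fun h => ⟨h, by omega⟩⟩,
      Multiset.filter_map, Multiset.filter_map, Multiset.card_add, Multiset.card_map,
      Multiset.card_map, ← Finset.card_filter_add_card_filter_not
        (s := Finset.univ.filter fun j => v < β j) (fun i : Fin N => (i : ℕ) < m),
      Finset.filter_comm, Finset.filter_comm (p := fun j => v < β j)]
    rfl

/-- A symmetric superpolynomial is determined by the coefficients of the leading terms of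
supermonomials. -/
theorem symmSuperPoly_eq_zero {N : ℕ} {f : SuperPoly N} (hf : f ∈ SymSuperPoly N)
    (h : ∀ (n m : ℕ) (Λ : SPar n m) (hm : m ≤ N), Λ.length ≤ N → Λ.leadCoeff hm f = 0) :
    f = 0 := by
  classical
  refine superPoly_eq_zero_of_superCoeff fun m α g => ?_
  have hsymm : ∀ (σ : Equiv.Perm (Fin N)) (α : Fin N →₀ ℕ) (g : Fin m → Fin N),
      superCoeff (α.mapDomain σ) (σ ∘ g) f = superCoeff α g f := fun σ α g => by
    have := superCoeff_permAct α g σ f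
    rwa [hf σ] at this
  by_cases hg : Function.Injective g
  swap
  · exact superCoeff_of_not_injective α hg f
  by_cases hαg : Function.Injective (α ∘ g)
  swap
  · simp only [Function.Injective, not_forall] at hαg
    obtain ⟨k, l, hkl, hne⟩ := hαg
    -- Two θ's carry the same exponent: swapping these variables fixes x^α and exchanges two θ's, so
    -- the coefficient equals its own negative.
    have h1 := hsymm (Equiv.swap (g k) (g l)) α g
    have h2 : α.mapDomain (Equiv.swap (g k) (g l)) = α := by
      ext i
      rw [Finsupp.mapDomain_equiv_apply, Equiv.symm_swap, Equiv.swap_apply_def]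
      simp only [Function.comp_apply] at hkl
      split_ifs with h3 h4
      · rw [h3, hkl]
      · rw [h4, hkl]
      · rfl
    have h3 : Equiv.swap (g k) (g l) ∘ g = g ∘ Equiv.swap k l := by
      funext i
      simp only [Function.comp_apply, Equiv.swap_apply_def, hg.eq_iff]
      split_ifs <;> rfl
    rw [h2, h3, superCoeff_comp_perm, Equiv.Perm.sign_swap hne] at h1
    simp only [Units.val_neg, Units.val_one] at h1
    linarith
  have hm : m ≤ N := by simpa using Fintype.card_le_of_injective g hg
  let tag : Fin N → ℕ := fun j => if j ∈ Set.range g then 1 else 0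
  -- The variables with a θ are put first, and each group is ordered by decreasing exponent; the
  -- dual is taken because `Tuple.sort` sorts increasingly.
  let key : Fin N → (ℕ ×ₗ ℕ)ᵒᵈ := fun j => OrderDual.toDual (toLex (tag j, α j))
  let σ := Tuple.sort key
  have hσ : ∀ i j, i ≤ j → tag (σ j) < tag (σ i) ∨ tag (σ j) = tag (σ i) ∧ α (σ j) ≤ α (σ i) :=
    fun i j hij => Prod.Lex.toLex_le_toLex.1 (OrderDual.toDual_le_toDual.1
      (Tuple.monotone_sort key hij))
  have htag : Antitone fun j => tag (σ j) := fun i j hij => by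
    rcases hσ i j hij with h1 | h1
    · exact h1.le
    · exact h1.1.le
  have htag1 : ∀ j, 0 < tag j ↔ j ∈ Set.range g := fun j => by
    simp only [tag]; split_ifs with h1 <;> simp [h1]
  have htag' : ∀ p : Fin N, 0 < tag (σ p) ↔ (p : ℕ) < m := by
    intro p
    rw [lt_apply_iff_of_antitone htag 0 p]
    have : (Finset.univ.filter fun q => 0 < tag (σ q)).card = m := by
      have h1 : (Finset.univ.filter fun q => 0 < tag (σ q)).card =
          (Finset.univ.map ⟨g, hg⟩).card := Finset.card_equiv σ fun i => by simp [htag1]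
      rw [h1, Finset.card_map, Finset.card_univ, Fintype.card_fin]
    rw [this]
  have hlt : ∀ k, ((σ.symm (g k) : Fin N) : ℕ) < m := fun k => by
    rw [← htag', htag1]; simp
  let t : Fin m → Fin m := fun k => ⟨σ.symm (g k), hlt k⟩
  have ht : Function.Injective t := fun a b hab => by
    have := congrArg Fin.val hab
    exact hg (σ.symm.injective (Fin.ext this))
  -- Sorting also reorders the θ's among themselves, which costs only the sign of `τ`.
  let τ : Equiv.Perm (Fin m) := Equiv.ofBijective t (Finite.injective_iff_bijective.1 ht)
  have hτ : σ.symm ∘ g = Fin.castLE hm ∘ τ := funext fun k => Fin.ext rfl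
  have hβ : ∀ i, (α.mapDomain σ.symm) i = α (σ i) := fun i => by
    rw [Finsupp.mapDomain_equiv_apply, Equiv.symm_symm]
  obtain ⟨Λ, hlen, hΛ⟩ := SPar.exists_exponent_eq hm (α.mapDomain σ.symm) (by
    intro i j hij hj
    rw [hβ, hβ]
    have hi : (i : ℕ) < m := lt_trans hij hj
    obtain ⟨k, hk⟩ := (htag1 _).1 ((htag' i).2 hi)
    obtain ⟨l, hl⟩ := (htag1 _).1 ((htag' j).2 hj)
    have hti : tag (σ i) = 1 := if_pos ⟨k, hk⟩
    have htj : tag (σ j) = 1 := if_pos ⟨l, hl⟩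
    rcases hσ i j hij.le with h1 | h1
    · omega
    · refine lt_of_le_of_ne h1.2 fun heq => ?_
      rw [← hk, ← hl] at heq
      have := hαg heq
      rw [this, hk] at hl
      exact hij.ne (σ.injective hl)) (by
    intro i j hi hij
    rw [hβ, hβ]
    rcases hσ i j hij with h1 | h1
    · have := (htag' i).1 (by omega)
      omega
    · exact h1.2)
  rw [← hsymm σ.symm α g, hτ, superCoeff_comp_perm, ← hΛ]
  have := h _ _ Λ hm hlen
  rw [SPar.leadCoeff] at this
  rw [this, mul_zero]

end

noncomputable section

/-! ## The elementary superfunctions are symmetric superfunctions -/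

/-- The elementary symmetric polynomial of degree `k` in the variables `x_j`, `j ∈ s`. -/
def esymmOn {N : ℕ} (s : Finset (Fin N)) (k : ℕ) : MvPolynomial (Fin N) ℤ :=
  ∑ J ∈ Finset.powersetCard k s, ∏ j ∈ J, MvPolynomial.X j

theorem elemBosonN_eq (N k : ℕ) : elemBosonN N k = esymmOn Finset.univ k ⊗ₜ 1 := rfl

theorem elemFermionN_eq (N k : ℕ) : elemFermionN N k =
    ∑ i : Fin N, esymmOn (Finset.univ.erase i) k ⊗ₜ ExteriorAlgebra.ι ℤ (Pi.single i (1 : ℤ)) := rfl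

theorem isHomogeneous_esymmOn {N : ℕ} (s : Finset (Fin N)) (k : ℕ) :
    (esymmOn s k).IsHomogeneous k := by
  refine MvPolynomial.IsHomogeneous.sum _ _ _ fun J hJ => ?_
  have := MvPolynomial.IsHomogeneous.prod J (fun j => (MvPolynomial.X j : MvPolynomial (Fin N) ℤ))
    (fun _ => 1) fun j _ => MvPolynomial.isHomogeneous_X _ _
  rwa [Finset.sum_const, smul_eq_mul, mul_one, (Finset.mem_powersetCard.1 hJ).2] at this

theorem rename_esymmOn {N : ℕ} (σ : Equiv.Perm (Fin N)) (s : Finset (Fin N)) (k : ℕ) :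
    MvPolynomial.rename σ (esymmOn s k) = esymmOn (s.map σ.toEmbedding) k := by
  rw [esymmOn, esymmOn, Finset.powersetCard_map, Finset.sum_map, map_sum]
  refine Finset.sum_congr rfl fun J _ => ?_
  rw [map_prod]
  simp [Finset.mapEmbedding_apply]

/-- Products containing the last variable vanish. The two inclusions accommodate both e_k (all
variables) and ẽ_k (one variable omitted). -/
theorem aeval_lastCases_esymmOn {N : ℕ} (s : Finset (Fin N)) (t : Finset (Fin (N + 1)))
    (hst : s.map Fin.castSuccEmb ⊆ t) (hts : t ⊆ insert (Fin.last N) (s.map Fin.castSuccEmb))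
    (k : ℕ) :
    MvPolynomial.aeval (Fin.lastCases (0 : MvPolynomial (Fin N) ℤ)
      fun i : Fin N => MvPolynomial.X i) (esymmOn t k) = esymmOn s k := by
  rw [esymmOn, esymmOn, map_sum]
  rw [← Finset.sum_subset (Finset.powersetCard_mono hst), Finset.powersetCard_map, Finset.sum_map]
  · refine Finset.sum_congr rfl fun J _ => ?_
    rw [map_prod]
    simp [Finset.mapEmbedding_apply]
  · intro J hJ hJ'
    rw [map_prod]
    refine Finset.prod_eq_zero (i := Fin.last N) ?_ ?_
    · by_contra hlast
      refine hJ' (Finset.mem_powersetCard.2 ⟨fun j hj => ?_, (Finset.mem_powersetCard.1 hJ).2⟩)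
      rcases Finset.mem_insert.1 (hts ((Finset.mem_powersetCard.1 hJ).1 hj)) with h | h
      · exact absurd (h ▸ hj) hlast
      · exact h
    · rw [MvPolynomial.aeval_X, Fin.lastCases_last]

theorem ι_single_mem {N : ℕ} (i : Fin N) :
    ExteriorAlgebra.ι ℤ (Pi.single i (1 : ℤ)) ∈ ⋀[ℤ]^1 (Fin N → ℤ) := by
  have := thetaMul_mem (fun _ : Fin 1 => i)
  rwa [thetaMul, ExteriorAlgebra.ιMulti_succ_apply, ExteriorAlgebra.ιMulti_zero_apply,
    mul_one] at this

theorem elemBosonN_mem_symm (N k : ℕ) : elemBosonN N k ∈ SymSuperPoly N := by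
  intro σ
  rw [elemBosonN_eq, permAct, Algebra.TensorProduct.map_tmul, rename_esymmOn,
    Finset.map_univ_equiv, map_one]

theorem elemFermionN_mem_symm (N k : ℕ) : elemFermionN N k ∈ SymSuperPoly N := by
  intro σ
  rw [elemFermionN_eq, map_sum, ← Equiv.sum_comp σ
    (fun i => esymmOn (Finset.univ.erase i) k ⊗ₜ[ℤ] ExteriorAlgebra.ι ℤ (Pi.single i (1 : ℤ)))]
  refine Finset.sum_congr rfl fun i _ => ?_
  rw [permAct, Algebra.TensorProduct.map_tmul, rename_esymmOn, ExteriorAlgebra.map_apply_ι]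
  congr 2
  · rw [Finset.map_erase, Finset.map_univ_equiv]
    rfl
  · funext j
    simp only [LinearMap.funLeft_apply, Pi.single_apply]
    exact if_congr (by rw [Equiv.symm_apply_eq]) rfl rfl

theorem elemBoson_mem (k : ℕ) : elemBoson k ∈ SymSuper k 0 := by
  refine ⟨fun N => elemBosonN_mem_symm N k, fun N => Submodule.subset_span
    ⟨_, _, isHomogeneous_esymmOn _ _, ?_, rfl⟩, fun N => ?_⟩
  · exact SetLike.one_mem_graded fun i => ⋀[ℤ]^i (Fin N → ℤ)
  · change restrictSuper N (esymmOn Finset.univ k ⊗ₜ 1) = esymmOn Finset.univ k ⊗ₜ 1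
    rw [restrictSuper, Algebra.TensorProduct.map_tmul, map_one,
      aeval_lastCases_esymmOn Finset.univ _ (Finset.subset_univ _)]
    intro j _
    refine Fin.lastCases (Finset.mem_insert_self _ _) (fun j => ?_) j
    exact Finset.mem_insert_of_mem (Finset.mem_map.2 ⟨j, Finset.mem_univ _, rfl⟩)

theorem elemFermion_mem (k : ℕ) : elemFermion k ∈ SymSuper k 1 := by
  refine ⟨fun N => elemFermionN_mem_symm N k, fun N => ?_, fun N => ?_⟩
  · change elemFermionN N k ∈ _
    rw [elemFermionN_eq]
    exact Submodule.sum_mem _ fun i _ => Submodule.subset_span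
      ⟨_, _, isHomogeneous_esymmOn (Finset.univ.erase i) k, ι_single_mem i, rfl⟩
  change restrictSuper N (elemFermionN (N + 1) k) = elemFermionN N k
  rw [elemFermionN_eq, elemFermionN_eq, map_sum, Fin.sum_univ_castSucc]
  have hlast : restrictSuper N (esymmOn (Finset.univ.erase (Fin.last N)) k ⊗ₜ
      ExteriorAlgebra.ι ℤ (Pi.single (Fin.last N) (1 : ℤ))) = 0 := by
    rw [restrictSuper, Algebra.TensorProduct.map_tmul, ExteriorAlgebra.map_apply_ι]
    have : LinearMap.funLeft ℤ ℤ (Fin.castSucc : Fin N → Fin (N + 1))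
        (Pi.single (Fin.last N) (1 : ℤ)) = 0 := by
      funext j
      rw [LinearMap.funLeft_apply, Pi.single_eq_of_ne (Fin.castSucc_lt_last j).ne, Pi.zero_apply]
    rw [this, map_zero, TensorProduct.tmul_zero]
  rw [hlast, add_zero]
  refine Finset.sum_congr rfl fun i _ => ?_
  rw [restrictSuper, Algebra.TensorProduct.map_tmul, ExteriorAlgebra.map_apply_ι,
    aeval_lastCases_esymmOn (Finset.univ.erase i)]
  · congr 2
    funext j
    rw [LinearMap.funLeft_apply, Pi.single_apply, Pi.single_apply]
    exact if_congr (Fin.castSucc_injective N).eq_iff rfl rfl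
  · intro j hj
    obtain ⟨j, hj', rfl⟩ := Finset.mem_map.1 hj
    exact Finset.mem_erase.2 ⟨fun h => (Finset.mem_erase.1 hj').1 (Fin.castSucc_injective N h),
      Finset.mem_univ _⟩
  · intro j
    refine Fin.lastCases (fun _ => Finset.mem_insert_self _ _) (fun j hj => ?_) j
    refine Finset.mem_insert_of_mem (Finset.mem_map.2 ⟨j, Finset.mem_erase.2 ⟨?_,
      Finset.mem_univ _⟩, rfl⟩)
    rintro rfl
    exact (Finset.mem_erase.1 hj).1 rfl

theorem mul_mem_homogSuperPoly {N n m n' m' : ℕ} {f g : SuperPoly N}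
    (hf : f ∈ homogSuperPoly N n m) (hg : g ∈ homogSuperPoly N n' m') :
    f * g ∈ homogSuperPoly N (n + n') (m + m') := by
  rw [homogSuperPoly] at hf hg
  induction hf using Submodule.span_induction with
  | zero => rw [zero_mul]; exact zero_mem _
  | add x y _ _ hx hy => rw [add_mul]; exact add_mem hx hy
  | smul a x _ hx => rw [smul_mul_assoc]; exact Submodule.smul_mem _ _ hx
  | mem x hx =>
    obtain ⟨p, w, hp, hw, rfl⟩ := hx
    induction hg using Submodule.span_induction with
    | zero => rw [mul_zero]; exact zero_mem _
    | add x y _ _ hx hy => rw [mul_add]; exact add_mem hx hy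
    | smul a x _ hx => rw [mul_smul_comm]; exact Submodule.smul_mem _ _ hx
    | mem y hy =>
      obtain ⟨q, v, hq, hv, rfl⟩ := hy
      rw [Algebra.TensorProduct.tmul_mul_tmul]
      refine Submodule.subset_span ⟨_, _, hp.mul hq, ?_, rfl⟩
      exact SetLike.mul_mem_graded (A := fun i => ⋀[ℤ]^i (Fin N → ℤ)) hw hv

theorem mul_mem_symSuper {n m n' m' : ℕ} {f g : SuperFamily} (hf : f ∈ SymSuper n m)
    (hg : g ∈ SymSuper n' m') : f * g ∈ SymSuper (n + n') (m + m') :=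
  ⟨fun N => mul_mem (hf.1 N) (hg.1 N), fun N => mul_mem_homogSuperPoly (hf.2.1 N) (hg.2.1 N),
    fun N => by rw [Pi.mul_apply, map_mul, hf.2.2 N, hg.2.2 N, Pi.mul_apply]⟩

theorem one_mem_symSuper : (1 : SuperFamily) ∈ SymSuper 0 0 := by
  refine ⟨fun N => one_mem _, fun N => Submodule.subset_span
    ⟨1, 1, MvPolynomial.isHomogeneous_one _ _, ?_, rfl⟩, fun N => map_one _⟩
  exact SetLike.one_mem_graded fun i => ⋀[ℤ]^i (Fin N → ℤ)

theorem prod_elemFermion_mem (l : List ℕ) :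
    (l.map elemFermion).prod ∈ SymSuper l.sum l.length := by
  induction l with
  | nil => exact one_mem_symSuper
  | cons a l ih =>
    rw [List.map_cons, List.prod_cons, List.sum_cons, List.length_cons, add_comm l.length]
    exact mul_mem_symSuper (elemFermion_mem a) ih

theorem prod_elemBoson_mem (l : List ℕ) : (l.map elemBoson).prod ∈ SymSuper l.sum 0 := by
  induction l with
  | nil => exact one_mem_symSuper
  | cons a l ih =>
    have := mul_mem_symSuper (elemBoson_mem a) ih
    rwa [add_zero] at this

theorem SPar.sum_antiList_add_sum_symmList {n m : ℕ} (Λ : SPar n m) :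
    Λ.antiList.sum + Λ.symmList.sum = n := by
  rw [← Multiset.sum_coe, ← Multiset.sum_coe, Λ.coe_antiList, Λ.coe_symmList, Λ.sum_eq]

theorem elemSuperRev_mem {n m : ℕ} (Λ : SPar n m) : elemSuperRev Λ ∈ SymSuper n m := by
  have := mul_mem_symSuper (prod_elemFermion_mem Λ.antiList.reverse)
    (prod_elemBoson_mem Λ.symmList)
  rwa [List.sum_reverse, List.length_reverse, Λ.sum_antiList_add_sum_symmList, Λ.length_antiList,
    add_zero] at this

theorem elemSuper_mem {n m : ℕ} (Λ : SPar n m) : elemSuper Λ ∈ SymSuper n m := by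
  have := mul_mem_symSuper (prod_elemFermion_mem Λ.antiList) (prod_elemBoson_mem Λ.symmList)
  rwa [Λ.sum_antiList_add_sum_symmList, Λ.length_antiList, add_zero] at this

/-! ## Reversing the order of the fermions -/

/-- The sign is left undetermined: neither spans nor the vanishing of a coefficient depend on it. -/
theorem prod_reverse_of_anticomm {R ι : Type*} [Ring R] (f : ι → R)
    (hf : ∀ a b, f a * f b + f b * f a = 0) (l : List ι) :
    (l.reverse.map f).prod = (l.map f).prod ∨ (l.reverse.map f).prod + (l.map f).prod = 0 := by
  have hf' : ∀ a b, f a * f b = -(f b * f a) := fun a b => eq_neg_of_add_eq_zero_left (hf a b)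
  have hcomm : ∀ (a : ι) (l : List ι),
      (l.map f).prod * f a = f a * (l.map f).prod ∨
      (l.map f).prod * f a = -(f a * (l.map f).prod) := by
    intro a l
    induction l with
    | nil => left; simp
    | cons b l ih =>
      simp only [List.map_cons, List.prod_cons]
      rcases ih with h | h
      · right
        rw [mul_assoc, h, ← mul_assoc, hf' b a, neg_mul, mul_assoc]
      · left
        rw [mul_assoc, h, mul_neg, ← mul_assoc, hf' b a, neg_mul, neg_neg, mul_assoc]
  rw [← eq_neg_iff_add_eq_zero]
  induction l with
  | nil => left; rfl
  | cons a l ih =>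
    simp only [List.reverse_cons, List.map_append, List.prod_append, List.map_cons,
      List.map_nil, List.prod_cons, List.prod_nil, mul_one]
    rcases ih with h | h <;> rcases hcomm a l with h' | h' <;> rw [h]
    · left; exact h'
    · right; exact h'
    · right; rw [neg_mul, h']
    · left; rw [neg_mul, h', neg_neg]

theorem tmul_ι_anticomm {N : ℕ} (p q : MvPolynomial (Fin N) ℤ) (u v : Fin N → ℤ) :
    (p ⊗ₜ[ℤ] ExteriorAlgebra.ι ℤ u) * (q ⊗ₜ[ℤ] ExteriorAlgebra.ι ℤ v) +
      (q ⊗ₜ[ℤ] ExteriorAlgebra.ι ℤ v) * (p ⊗ₜ[ℤ] ExteriorAlgebra.ι ℤ u) = 0 := by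
  rw [Algebra.TensorProduct.tmul_mul_tmul, Algebra.TensorProduct.tmul_mul_tmul, mul_comm q p,
    ← TensorProduct.tmul_add, ExteriorAlgebra.ι_add_mul_swap, TensorProduct.tmul_zero]

theorem elemFermion_anticomm (a b : ℕ) :
    elemFermion a * elemFermion b + elemFermion b * elemFermion a = 0 := by
  funext N
  change elemFermionN N a * elemFermionN N b + elemFermionN N b * elemFermionN N a = 0
  rw [elemFermionN_eq, elemFermionN_eq, Finset.sum_mul_sum, Finset.sum_mul_sum, Finset.sum_comm,
    ← Finset.sum_add_distrib]
  refine Finset.sum_eq_zero fun i _ => ?_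
  rw [← Finset.sum_add_distrib]
  exact Finset.sum_eq_zero fun j _ => tmul_ι_anticomm _ _ _ _

theorem elemSuperRev_eq_or_add_eq_zero {n m : ℕ} (Λ : SPar n m) :
    elemSuperRev Λ = elemSuper Λ ∨ elemSuperRev Λ + elemSuper Λ = 0 := by
  rw [elemSuperRev, elemSuper]
  rcases prod_reverse_of_anticomm elemFermion elemFermion_anticomm Λ.antiList with h | h
  · left; rw [h]
  · right; rw [← add_mul, h, zero_mul]

end

/-! ## Row and column sums of `0`-`1` matrices -/

section GaleRyser

variable {N : ℕ} {I : Type*} [Fintype I] {r : I → ℕ} {J : I → Finset (Fin N)}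
  {π : Equiv.Perm (Fin N)} {s : ℕ → ℕ}

theorem sum_range_card_lt (r : I → ℕ) (k : ℕ) :
    ∑ p ∈ Finset.range k, (Finset.univ.filter fun i => p < r i).card = ∑ i, min k (r i) := by
  simp_rw [Finset.card_filter]
  rw [Finset.sum_comm]
  refine Finset.sum_congr rfl fun i _ => ?_
  rw [← Finset.card_filter]
  have : (Finset.range k).filter (· < r i) = Finset.range (min k (r i)) := by
    ext p; simp
  rw [this, Finset.card_range]

theorem sum_range_columns
    (hs : ∀ p : Fin N, s p = (Finset.univ.filter fun i => π p ∈ J i).card)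
    (hs0 : ∀ p, N ≤ p → s p = 0) (k : ℕ) :
    ∑ p ∈ Finset.range k, s p =
      ∑ i, (Finset.univ.filter fun p : Fin N => (p : ℕ) < k ∧ π p ∈ J i).card := by
  have h1 : ∑ p ∈ Finset.range k, s p = ∑ p : Fin N, if (p : ℕ) < k then s p else 0 := by
    rw [Fin.sum_univ_eq_sum_range (fun p => if p < k then s p else 0), ← Finset.sum_filter]
    have h2 : (Finset.range N).filter (· < k) = Finset.range (min k N) := by
      ext p; simp; omega
    rw [h2]
    symm
    refine Finset.sum_subset (fun p hp => ?_) fun p hp hp' => hs0 p ?_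
    · simp only [Finset.mem_range] at hp ⊢; omega
    · simp only [Finset.mem_range] at hp hp'; omega
  rw [h1]
  simp_rw [Finset.card_filter]
  rw [Finset.sum_comm]
  refine Finset.sum_congr rfl fun p _ => ?_
  by_cases hp : (p : ℕ) < k
  · simp [hp, hs]
  · simp [hp]

theorem card_filter_le_min (hJ : ∀ i, (J i).card = r i) (k : ℕ) (i : I) :
    (Finset.univ.filter fun p : Fin N => (p : ℕ) < k ∧ π p ∈ J i).card ≤ min k (r i) := by
  refine le_min ?_ ?_
  · refine (Finset.card_le_card (t := Finset.univ.filter fun p : Fin N => (p : ℕ) < k) ?_).trans ?_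
    · intro p hp
      simp only [Finset.mem_filter, Finset.mem_univ, true_and] at hp ⊢
      exact hp.1
    · rw [Fin.card_filter_val_lt]
      exact min_le_right _ _
  · rw [← hJ i]
    refine Finset.card_le_card_of_injOn π (fun p hp => ?_) π.injective.injOn
    simp only [Finset.coe_filter, Finset.mem_univ, true_and, Set.mem_ofPred_eq] at hp
    exact hp.2

/-- Row `i` has at most `min k (r i)` entries in the first `k` columns, and these bounds add up to a
partial sum of the conjugate partition. -/
theorem sum_columns_le (hJ : ∀ i, (J i).card = r i)
    (hs : ∀ p : Fin N, s p = (Finset.univ.filter fun i => π p ∈ J i).card)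
    (hs0 : ∀ p, N ≤ p → s p = 0) (k : ℕ) :
    ∑ p ∈ Finset.range k, s p ≤
      ∑ p ∈ Finset.range k, (Finset.univ.filter fun i => p < r i).card := by
  rw [sum_range_columns hs hs0, sum_range_card_lt]
  exact Finset.sum_le_sum fun i _ => card_filter_le_min hJ k i

/-- Equality of the partial sums forces equality in every row and for every `k`. At `k = r i` the
row fills its first `r i` columns, which exhausts its size. -/
theorem mem_iff_of_columns_eq (hJ : ∀ i, (J i).card = r i)
    (hs : ∀ p : Fin N, s p = (Finset.univ.filter fun i => π p ∈ J i).card)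
    (hs0 : ∀ p, N ≤ p → s p = 0)
    (heq : ∀ p, s p = (Finset.univ.filter fun i => p < r i).card) (i : I) (p : Fin N) :
    π p ∈ J i ↔ (p : ℕ) < r i := by
  have h1 : ∀ k, (Finset.univ.filter fun p : Fin N => (p : ℕ) < k ∧ π p ∈ J i).card =
      min k (r i) := by
    intro k
    have h2 := sum_range_columns hs hs0 k
    simp_rw [heq] at h2
    rw [sum_range_card_lt] at h2
    exact (Finset.sum_eq_sum_iff_of_le fun i _ => card_filter_le_min hJ k i).1 h2.symm i
      (Finset.mem_univ i)
  have h3 := h1 (r i)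
  rw [min_self] at h3
  have hsub1 : (Finset.univ.filter fun p : Fin N => (p : ℕ) < r i ∧ π p ∈ J i) ⊆
      Finset.univ.filter fun p : Fin N => (p : ℕ) < r i := by
    intro p hp
    simp only [Finset.mem_filter, Finset.mem_univ, true_and] at hp ⊢
    exact hp.1
  have hsub2 : (Finset.univ.filter fun p : Fin N => (p : ℕ) < r i ∧ π p ∈ J i) ⊆
      Finset.univ.filter fun p : Fin N => π p ∈ J i := by
    intro p hp
    simp only [Finset.mem_filter, Finset.mem_univ, true_and] at hp ⊢
    exact hp.2
  have heq1 := Finset.eq_of_subset_of_card_le hsub1 (by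
    rw [h3, Fin.card_filter_val_lt]; exact min_le_right _ _)
  have heq2 := Finset.eq_of_subset_of_card_le hsub2 (by
    rw [h3, ← hJ i]
    refine Finset.card_le_card_of_injOn π (fun p hp => ?_) π.injective.injOn
    simpa using hp)
  have := Finset.ext_iff.1 (heq2.symm.trans heq1) p
  simpa using this

end GaleRyser

noncomputable section

/-! ## Expansion of the reversed elementary superfunctions -/

theorem prod_ofFn_fermion {N : ℕ} (m : ℕ) (p : Fin m → Fin N → MvPolynomial (Fin N) ℤ) :
    (List.ofFn fun k => ∑ i : Fin N,
      p k i ⊗ₜ[ℤ] ExteriorAlgebra.ι ℤ (Pi.single i (1 : ℤ) : Fin N → ℤ)).prod =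
      ∑ g : Fin m → Fin N, (∏ k, p k (g k)) ⊗ₜ[ℤ] thetaMul g := by
  induction m with
  | zero =>
    rw [List.ofFn_zero, List.prod_nil, Fintype.sum_unique, thetaMul,
      ExteriorAlgebra.ιMulti_zero_apply, Finset.univ_eq_empty, Finset.prod_empty]
    rfl
  | succ m ih =>
    rw [List.ofFn_succ, List.prod_cons, ih fun k => p k.succ, Finset.sum_mul_sum,
      ← (Fin.consEquiv fun _ => Fin N).sum_comp, Fintype.sum_prod_type]
    refine Finset.sum_congr rfl fun i _ => Finset.sum_congr rfl fun g _ => ?_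
    rw [Algebra.TensorProduct.tmul_mul_tmul, Fin.prod_univ_succ, thetaMul, thetaMul,
      ExteriorAlgebra.ιMulti_succ_apply]
    rfl

/-- Choosing a monomial in each factor is choosing the rows of a 0-1 matrix; its column sums form
the resulting exponent vector. -/
theorem coeff_prod_esymmOn {N : ℕ} {I : Type*} [Fintype I] [DecidableEq I] (r : I → ℕ)
    (S : I → Finset (Fin N)) (α : Fin N →₀ ℕ) :
    (∏ i, esymmOn (S i) (r i)).coeff α =
      ((Fintype.piFinset fun i => Finset.powersetCard (r i) (S i)).filter fun J =>
        ∀ j, (Finset.univ.filter fun i => j ∈ J i).card = α j).card := by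
  have h1 : ∀ J : I → Finset (Fin N), ∏ i, ∏ j ∈ J i, (MvPolynomial.X j : MvPolynomial (Fin N) ℤ) =
      MvPolynomial.monomial (Finsupp.equivFunOnFinite.symm fun j =>
        (Finset.univ.filter fun i => j ∈ J i).card) 1 := by
    intro J
    have h2 : ∀ i, ∏ j ∈ J i, (MvPolynomial.X j : MvPolynomial (Fin N) ℤ) =
        ∏ j, if j ∈ J i then MvPolynomial.X j else 1 := fun i => by
      rw [Finset.prod_ite_mem, Finset.univ_inter]
    simp_rw [h2]
    rw [Finset.prod_comm, MvPolynomial.monomial_eq, map_one, one_mul,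
      Finsupp.prod_fintype _ _ fun i => pow_zero _]
    refine Finset.prod_congr rfl fun j _ => ?_
    rw [← Finset.prod_filter, Finset.prod_const]
    rfl
  simp_rw [esymmOn]
  rw [Finset.prod_univ_sum, MvPolynomial.coeff_sum, Finset.card_filter, Nat.cast_sum]
  refine Finset.sum_congr rfl fun J _ => ?_
  rw [h1, MvPolynomial.coeff_monomial, Nat.cast_ite, Nat.cast_one, Nat.cast_zero]
  refine if_congr ⟨fun h j => ?_, fun h => ?_⟩ rfl rfl
  · rw [← h]; rfl
  · ext j; exact h j

namespace SPar

variable {n m : ℕ}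

/-- The parts of `Λ`: first those of `Λᵃ` in increasing order, then those of `Λˢ`. -/
def rows (Λ : SPar n m) : Fin m ⊕ Fin Λ.symmList.length → ℕ :=
  Sum.elim (Λ.anti.orderEmbOfFin Λ.card_anti) Λ.symmList.get

theorem reverse_antiList (Λ : SPar n m) :
    Λ.antiList.reverse = List.ofFn (Λ.anti.orderEmbOfFin Λ.card_anti) := by
  have h1 : List.ofFn (Λ.anti.orderEmbOfFin Λ.card_anti) = Λ.anti.sort (· ≤ ·) := by
    rw [List.ofFn_eq_map, Finset.listMap_orderEmbOfFin_finRange]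
  rw [h1]
  refine List.Perm.eq_of_pairwise' (r := (· ≤ ·)) ?_ (Finset.pairwise_sort _ _) ?_
  · rw [List.pairwise_reverse]
    exact Λ.pairwise_antiList.imp fun h => le_of_lt h
  · refine (List.reverse_perm _).trans ?_
    rw [← Multiset.coe_eq_coe, Λ.coe_antiList, Finset.sort_eq]

theorem numGT_eq_card_rows (Λ : SPar n m) (v : ℕ) :
    Λ.numGT v = (Finset.univ.filter fun i => v < Λ.rows i).card := by
  have h1 : ∀ (l : List ℕ) (v : ℕ), (l.filter (v < ·)).length =
      (Finset.univ.filter fun t : Fin l.length => v < l.get t).card := by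
    intro l v
    conv_lhs => rw [← List.ofFn_get l, List.ofFn_eq_map, List.filter_map, List.length_map]
    rfl
  have h2 : (Λ.antiList.filter (v < ·)).length =
      (Finset.univ.filter fun k : Fin m => v < Λ.anti.orderEmbOfFin Λ.card_anti k).card := by
    rw [← List.length_reverse, ← List.filter_reverse, reverse_antiList, List.ofFn_eq_map,
      List.filter_map, List.length_map]
    rfl
  rw [← length_filter_toComp, toComp, List.filter_append, List.length_append, h2, h1,
    Finset.card_filter, Finset.card_filter, Finset.card_filter, Fintype.sum_sum_type]
  rfl

/-- `numGT` reverses the order, so Λᵃ listed increasingly matches Λ'ᵃ listed decreasingly. This is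
why the fermions are reversed. -/
theorem compEntry_conj (Λ : SPar n m) (k : Fin m) :
    compEntry Λ.conj.toComp k = Λ.numGT (Λ.anti.orderEmbOfFin Λ.card_anti k) := by
  have h1 : Λ.conj.antiList =
      List.ofFn fun k => Λ.numGT (Λ.anti.orderEmbOfFin Λ.card_anti k) := by
    have h2 : (List.ofFn fun k => Λ.numGT (Λ.anti.orderEmbOfFin Λ.card_anti k)) =
        (List.ofFn (Λ.anti.orderEmbOfFin Λ.card_anti)).map Λ.numGT := by
      rw [List.map_ofFn]; rfl
    refine List.Perm.eq_of_pairwise' (r := (· ≥ ·)) (Λ.conj.pairwise_antiList.imp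
      fun h => le_of_lt h) ?_ ?_
    · rw [List.pairwise_ofFn]
      intro i j hij
      exact Λ.antitone_numGT ((Λ.anti.orderEmbOfFin Λ.card_anti).monotone hij.le)
    · rw [← Multiset.coe_eq_coe, coe_antiList, h2, ← reverse_antiList, ← Multiset.map_coe,
        Multiset.coe_reverse, coe_antiList]
      exact Λ.conjAnti_val
  rw [compEntry_toComp_of_lt _ k.2]
  simp only [h1, List.getElem_ofFn]

end SPar

theorem elemSuperRev_apply {n m : ℕ} (Λ : SPar n m) (N : ℕ) :
    elemSuperRev Λ N = ∑ g : Fin m → Fin N,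
      (∏ i, esymmOn (Sum.elim (fun k => Finset.univ.erase (g k)) (fun _ => Finset.univ) i)
        (Λ.rows i)) ⊗ₜ[ℤ] thetaMul g := by
  have hB : ∀ l : List ℕ, (l.map elemBoson).prod N =
      (∏ t : Fin l.length, esymmOn Finset.univ (l.get t)) ⊗ₜ[ℤ] 1 := by
    intro l
    induction l with
    | nil => rfl
    | cons a l ih =>
      rw [List.map_cons, List.prod_cons, Pi.mul_apply, ih]
      change (esymmOn Finset.univ a ⊗ₜ[ℤ] 1) * _ = _
      rw [Algebra.TensorProduct.tmul_mul_tmul, mul_one]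
      congr 1
      exact (Fin.prod_univ_succ (n := l.length) fun t =>
        esymmOn (N := N) Finset.univ ((a :: l).get t)).symm
  have hF : (Λ.antiList.reverse.map elemFermion).prod N = ∑ g : Fin m → Fin N,
      (∏ k, esymmOn (Finset.univ.erase (g k)) (Λ.anti.orderEmbOfFin Λ.card_anti k)) ⊗ₜ[ℤ]
        thetaMul g := by
    rw [Pi.list_prod_apply, List.map_map, Λ.reverse_antiList, List.map_ofFn]
    exact prod_ofFn_fermion m fun k i =>
      esymmOn (Finset.univ.erase i) (Λ.anti.orderEmbOfFin Λ.card_anti k)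
  rw [elemSuperRev, Pi.mul_apply, hB, hF, Finset.sum_mul]
  refine Finset.sum_congr rfl fun g _ => ?_
  rw [Algebra.TensorProduct.tmul_mul_tmul, mul_one, Fintype.prod_sum_type]
  rfl

theorem SPar.exists_perm_sortedEntry {n m N : ℕ} (Γ : SPar n m) (h : Γ.length ≤ N) :
    (∃ π : Equiv.Perm (Fin N), ∀ p : Fin N, Γ.exponent N (π p) = Γ.sortedEntry p) ∧
      ∀ p, N ≤ p → Γ.sortedEntry p = 0 := by
  constructor
  · let key : Fin N → ℕᵒᵈ := fun j => OrderDual.toDual (Γ.exponent N j)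
    have hanti : Antitone fun p => Γ.exponent N (Tuple.sort key p) := fun p q hpq =>
      OrderDual.toDual_le_toDual.1 (Tuple.monotone_sort key hpq)
    refine ⟨Tuple.sort key, fun p => eq_of_forall_lt_iff fun v => ?_⟩
    rw [Γ.lt_sortedEntry, Γ.numGT_eq_card h, lt_apply_iff_of_antitone hanti v p]
    have : (Finset.univ.filter fun q => v < Γ.exponent N (Tuple.sort key q)).card =
        (Finset.univ.filter fun q => v < Γ.exponent N q).card :=
      Finset.card_equiv (Tuple.sort key) fun i => by simp
    rw [this]
  · intro p hp
    by_contra h'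
    have h1 := (Γ.lt_sortedEntry 0 p).1 (Nat.pos_of_ne_zero h')
    rw [Γ.numGT_eq_card h] at h1
    have := Finset.card_filter_le Finset.univ fun j : Fin N => 0 < Γ.exponent N j
    rw [Finset.card_univ, Fintype.card_fin] at this
    omega

theorem leadCoeff_elemSuperRev {n m n' N : ℕ} (Λ : SPar n m) (Γ : SPar n' m) (h : m ≤ N) :
    Γ.leadCoeff h (elemSuperRev Λ N) = ∑ g : Fin m → Fin N,
      (((Fintype.piFinset fun i => Finset.powersetCard (Λ.rows i)
        (Sum.elim (fun k => Finset.univ.erase (g k)) (fun _ => Finset.univ) i)).filter fun J =>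
        ∀ j, (Finset.univ.filter fun i => j ∈ J i).card = Γ.exponent N j).card : ℤ) *
      thetaCoeff (Fin.castLE h) (thetaMul g) := by
  rw [elemSuperRev_apply, map_sum]
  refine Finset.sum_congr rfl fun g _ => ?_
  rw [SPar.leadCoeff, superCoeff_tmul, coeff_prod_esymmOn]

theorem injective_of_thetaCoeff_ne_zero {N m m' : ℕ} {g : Fin m → Fin N} {g' : Fin m' → Fin N}
    (h : thetaCoeff g' (thetaMul g) ≠ 0) : Function.Injective g := by
  intro a b hab
  by_contra hne
  refine h ?_
  have : thetaMul g = 0 :=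
    AlternatingMap.map_eq_zero_of_eq _ _ (by simp only [hab]) hne
  rw [this, map_zero]

/-- The combinatorial consequence of the occurrence of a term of `m_Γ` in `e_Λ`. -/
theorem exists_of_term_ne_zero {n m N : ℕ} {Λ Γ : SPar n m} (h : m ≤ N) (hΓ : Γ.length ≤ N)
    {g : Fin m → Fin N} {J : Fin m ⊕ Fin Λ.symmList.length → Finset (Fin N)}
    (hJ : ∀ i, J i ⊆ Sum.elim (fun k => Finset.univ.erase (g k)) (fun _ => Finset.univ) i)
    (hcard : ∀ i, (J i).card = Λ.rows i)
    (hcol : ∀ j, (Finset.univ.filter fun i => j ∈ J i).card = Γ.exponent N j)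
    (hg : thetaCoeff (Fin.castLE h) (thetaMul g) ≠ 0) :
    (∀ k, ∑ p ∈ Finset.range k, Γ.sortedEntry p ≤ ∑ p ∈ Finset.range k, Λ.numGT p) ∧
    ((∀ p, Γ.sortedEntry p = Λ.numGT p) → ∃ τ : Fin m → Fin m, Function.Injective τ ∧
      (∀ k, g k = Fin.castLE h (τ k)) ∧
      ∀ k, compEntry Γ.toComp (τ k) ≤ compEntry Λ.conj.toComp k) := by
  obtain ⟨⟨π, hπ⟩, hs0⟩ := Γ.exists_perm_sortedEntry hΓ
  have hs : ∀ p : Fin N, Γ.sortedEntry p = (Finset.univ.filter fun i => π p ∈ J i).card :=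
    fun p => by rw [hcol, hπ]
  refine ⟨fun k => ?_, fun heq => ?_⟩
  · simp_rw [Λ.numGT_eq_card_rows]
    exact sum_columns_le hcard hs hs0 k
  · choose τ hτ using exists_of_thetaCoeff_thetaMul_ne_zero hg
    refine ⟨τ, fun a b hab => ?_, hτ, fun k => ?_⟩
    · exact injective_of_thetaCoeff_ne_zero hg (by rw [hτ, hτ, hab])
    · have h1 := mem_iff_of_columns_eq hcard hs hs0
        (fun p => by rw [heq, Λ.numGT_eq_card_rows]) (Sum.inl k) (π.symm (g k))
      rw [Equiv.apply_symm_apply] at h1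
      -- Row `k` omits the variable of its own θ, so that column lies outside the forced initial
      -- segment: its sorted position is at least the row length.
      have h2 : g k ∉ J (Sum.inl k) := fun h2 => by
        have := hJ _ h2
        simp at this
      have h3 := not_lt.1 (h1.not.1 h2)
      have h4 := hπ (π.symm (g k))
      rw [Equiv.apply_symm_apply, heq] at h4
      rw [Λ.compEntry_conj]
      calc compEntry Γ.toComp (τ k) = Γ.exponent N (g k) := by
            rw [hτ k]; rfl
        _ = _ := h4
        _ ≤ _ := Λ.antitone_numGT h3

theorem le_of_leadCoeff_elemSuperRev_ne_zero {n m N : ℕ} {Λ Γ : SPar n m} (h : m ≤ N)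
    (hΓ : Γ.length ≤ N) (hne : Γ.leadCoeff h (elemSuperRev Λ N) ≠ 0) :
    (∀ k, ∑ p ∈ Finset.range k, Γ.sortedEntry p ≤
      ∑ p ∈ Finset.range k, Λ.conj.sortedEntry p) ∧
    (Γ.sortedEntry = Λ.conj.sortedEntry → ∀ i < m,
      compEntry Γ.toComp i ≤ compEntry Λ.conj.toComp i) := by
  rw [leadCoeff_elemSuperRev] at hne
  obtain ⟨g, -, hg⟩ := Finset.exists_ne_zero_of_sum_ne_zero hne
  obtain ⟨J, hJ⟩ := Finset.card_pos.1 (Nat.pos_of_ne_zero fun h0 => hg (by rw [h0]; simp))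
  rw [Finset.mem_filter, Fintype.mem_piFinset] at hJ
  simp_rw [Finset.mem_powersetCard] at hJ
  obtain ⟨h1, h2⟩ := exists_of_term_ne_zero h hΓ (fun i => (hJ.1 i).1) (fun i => (hJ.1 i).2) hJ.2
    (right_ne_zero_of_mul hg)
  simp_rw [Λ.sortedEntry_conj]
  refine ⟨h1, fun heq i hi => ?_⟩
  obtain ⟨τ, hτ, -, hle⟩ := h2 fun p => by rw [heq, Λ.sortedEntry_conj]
  -- Pigeonhole: the `m - i` indices from `i` on cannot be injected into the `m - i - 1` indices
  -- above `i`.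
  obtain ⟨k, hk, hki⟩ : ∃ k : Fin m, i ≤ (k : ℕ) ∧ (τ k : ℕ) ≤ i := by
    by_contra hcon
    push Not at hcon
    have hc : (Finset.Ici (⟨i, hi⟩ : Fin m)).card ≤ (Finset.Ioi (⟨i, hi⟩ : Fin m)).card :=
      Finset.card_le_card_of_injOn τ (fun k hk => by
        simp only [Finset.coe_Ici, Set.mem_Ici, Finset.coe_Ioi, Set.mem_Ioi] at hk ⊢
        exact hcon k hk) hτ.injOn
    rw [Fin.card_Ici, Fin.card_Ioi] at hc
    simp only at hc
    omega
  have hmono : ∀ (Δ : SPar n m) {a b : ℕ}, a ≤ b → b < m →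
      compEntry Δ.toComp b ≤ compEntry Δ.toComp a := by
    intro Δ a b hab hb
    rcases hab.eq_or_lt with rfl | hlt
    · exact le_rfl
    · exact (Δ.compEntry_toComp_lt hlt hb).le
  exact (hmono Γ hki hi).trans ((hle k).trans (hmono Λ.conj hk k.2))

theorem SPar.rows_le {n m N : ℕ} (Λ : SPar n m) (hN : Λ.conj.length ≤ N)
    (i : Fin m ⊕ Fin Λ.symmList.length) : Λ.rows i ≤ N := by
  by_contra h
  have h1 : 0 < Λ.numGT N := by
    rw [Λ.numGT_eq_card_rows, Finset.card_pos]
    exact ⟨i, Finset.mem_filter.2 ⟨Finset.mem_univ _, not_le.1 h⟩⟩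
  rw [← Λ.sortedEntry_conj, (Λ.conj.exists_perm_sortedEntry hN).2 N le_rfl] at h1
  exact lt_irrefl _ h1

theorem leadCoeff_elemSuperRev_conj {n m N : ℕ} (Λ : SPar n m) (h : m ≤ N)
    (hN : Λ.conj.length ≤ N) : Λ.conj.leadCoeff h (elemSuperRev Λ N) = 1 := by
  rw [leadCoeff_elemSuperRev, Finset.sum_eq_single (Fin.castLE h)]
  · rw [thetaCoeff_thetaMul_self (Fin.castLE_injective h), mul_one, Nat.cast_eq_one,
      Finset.card_eq_one]
    obtain ⟨⟨π, hπ⟩, hs0⟩ := Λ.conj.exists_perm_sortedEntry hN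
    refine ⟨fun i => (Finset.univ.filter fun p : Fin N => (p : ℕ) < Λ.rows i).map π.toEmbedding, ?_⟩
    ext J
    rw [Finset.mem_filter, Fintype.mem_piFinset, Finset.mem_singleton]
    simp_rw [Finset.mem_powersetCard]
    constructor
    · rintro ⟨h1, h2⟩
      have key := mem_iff_of_columns_eq (π := π) (s := Λ.conj.sortedEntry) (fun i => (h1 i).2)
        (fun p => by rw [h2, hπ]) hs0
        (fun p => by rw [Λ.sortedEntry_conj, Λ.numGT_eq_card_rows])
      funext i
      ext j
      have := key i (π.symm j)
      rw [Equiv.apply_symm_apply] at this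
      rw [this]
      simp [Finset.mem_map_equiv]
    · rintro rfl
      refine ⟨fun i => ⟨?_, ?_⟩, fun j => ?_⟩
      · rcases i with k | t
        · intro j hj
          simp only [Finset.mem_map_equiv, Finset.mem_filter, Finset.mem_univ, true_and] at hj
          refine Finset.mem_erase.2 ⟨?_, Finset.mem_univ _⟩
          rintro rfl
          have h4 := hπ (π.symm (Fin.castLE h k))
          rw [Equiv.apply_symm_apply, Λ.sortedEntry_conj, SPar.exponent_apply, Fin.val_castLE,
            Λ.compEntry_conj] at h4
          -- With `b` the `k`-th antisymmetric part, a sorted position below `b` has a column longer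
          -- than `numGT b`, since `b` itself is a part; the column of the `k`-th θ has length
          -- exactly `numGT b`.
          have h5 := Λ.numGT_lt_numGT (Finset.orderEmbOfFin_mem Λ.anti Λ.card_anti k) hj
          omega
        · exact Finset.subset_univ _
      · rw [Finset.card_map, Fin.card_filter_val_lt]
        exact min_eq_right (Λ.rows_le hN i)
      · have h4 := hπ (π.symm j)
        rw [Equiv.apply_symm_apply, Λ.sortedEntry_conj] at h4
        rw [h4, Λ.numGT_eq_card_rows]
        congr 1
        ext i
        simp [Finset.mem_map_equiv]
  · intro g _ hne
    by_contra hterm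
    obtain ⟨J, hJ⟩ := Finset.card_pos.1 (Nat.pos_of_ne_zero fun h0 => hterm (by rw [h0]; simp))
    rw [Finset.mem_filter, Fintype.mem_piFinset] at hJ
    simp_rw [Finset.mem_powersetCard] at hJ
    obtain ⟨-, h2⟩ := exists_of_term_ne_zero h hN (fun i => (hJ.1 i).1) (fun i => (hJ.1 i).2) hJ.2
      (right_ne_zero_of_mul hterm)
    obtain ⟨τ, hτ, hgτ, hle⟩ := h2 Λ.sortedEntry_conj
    -- The antisymmetric entries of Λ' decrease strictly, so the inequality `hle` says `k ≤ τ k`.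
    have : τ = id := Fin.eq_id_of_le_apply hτ fun k => by
      by_contra hk
      exact absurd (hle k) (not_le.2 (Λ.conj.compEntry_toComp_lt (not_le.1 hk) k.2))
    exact hne (funext fun k => by rw [hgτ, this, id])
  · exact fun h' => absurd (Finset.mem_univ _) h'

end

/-! ## Triangularity -/

noncomputable section

namespace SPar

variable {n m : ℕ}

/-- A linear invariant that is strictly monotone for the order in which the transition matrix from
elementary superfunctions to supermonomials is triangular. -/
def rank (Λ : SPar n m) : ℕ ×ₗ ℕ :=
  toLex (∑ k ∈ Finset.range (n + 1), ∑ p ∈ Finset.range k, Λ.sortedEntry p,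
    ∑ i ∈ Finset.range m, compEntry Λ.toComp i)

theorem sortedEntry_eq_zero (Λ : SPar n m) {p : ℕ} (hp : n ≤ p) : Λ.sortedEntry p = 0 := by
  rw [← numGT_conj, numGT_eq_zero _ hp]

theorem rank_lt_rank {Ω Γ : SPar n m}
    (h1 : ∀ k, ∑ p ∈ Finset.range k, Ω.sortedEntry p ≤ ∑ p ∈ Finset.range k, Γ.sortedEntry p)
    (h2 : Ω.sortedEntry = Γ.sortedEntry → ∀ i < m, compEntry Ω.toComp i ≤ compEntry Γ.toComp i)
    (hne : Ω ≠ Γ) : Ω.rank < Γ.rank := by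
  rw [rank, rank, Prod.Lex.toLex_lt_toLex]
  dsimp only
  by_cases h : Ω.sortedEntry = Γ.sortedEntry
  · refine Or.inr ⟨by rw [h], lt_of_le_of_ne
      (Finset.sum_le_sum fun i hi => h2 h i (Finset.mem_range.1 hi)) fun heq => hne ?_⟩
    rw [Finset.sum_eq_sum_iff_of_le fun i hi => h2 h i (Finset.mem_range.1 hi)] at heq
    refine ext_of_sortedEntry h ?_
    rw [Ω.anti_eq_image le_rfl, Γ.anti_eq_image le_rfl]
    congr 1
    funext k
    exact heq k (Finset.mem_range.2 k.2)
  · refine Or.inl (lt_of_le_of_ne (Finset.sum_le_sum fun k _ => h1 k) fun heq => h ?_)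
    rw [Finset.sum_eq_sum_iff_of_le fun k _ => h1 k] at heq
    funext p
    rcases lt_or_ge p n with hp | hp
    · have h3 := heq p (Finset.mem_range.2 (by omega))
      have h4 := heq (p + 1) (Finset.mem_range.2 (by omega))
      rw [Finset.sum_range_succ, Finset.sum_range_succ] at h4
      omega
    · rw [sortedEntry_eq_zero _ hp, sortedEntry_eq_zero _ hp]

theorem bruhatLE_of_le {Ω Γ : SPar n m}
    (h1 : ∀ k, ∑ p ∈ Finset.range k, Ω.sortedEntry p ≤ ∑ p ∈ Finset.range k, Γ.sortedEntry p)
    (h2 : Ω.sortedEntry = Γ.sortedEntry → ∀ i < m, compEntry Ω.toComp i ≤ compEntry Γ.toComp i) :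
    Ω.BruhatLE Γ := by
  by_cases h : Ω.sortedEntry = Γ.sortedEntry
  · exact bruhatLE_of_sortedEntry_eq h (h2 h)
  · exact Or.inl ⟨h1, h⟩

/-- The coefficient of `m_Λ` in a symmetric superfunction. -/
def familyCoeff (Λ : SPar n m) (f : SuperFamily) : ℤ := Λ.leadCoeff Λ.le_length (f Λ.length)

/-- Beyond `Λ.length` each new variable has exponent zero in the leading term, so truncation
preserves the coefficient. -/
theorem leadCoeff_eq_familyCoeff {n' m' : ℕ} (Λ : SPar n m) {f : SuperFamily}
    (hf : f ∈ SymSuper n' m') {N : ℕ} (hN : Λ.length ≤ N) (h : m ≤ N) :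
    Λ.leadCoeff h (f N) = Λ.familyCoeff f := by
  induction N, hN using Nat.le_induction with
  | base => rfl
  | succ N hN ih =>
    rw [← ih (Λ.le_length.trans hN), ← hf.2.2 N, leadCoeff, leadCoeff, superCoeff_restrictSuper]
    congr 2
    ext i
    refine Fin.lastCases ?_ (fun i => ?_) i
    · rw [Finsupp.mapDomain_of_notMem_range]
      · rw [exponent_apply, compEntry, List.getD_eq_default]
        rw [length_toComp]
        exact hN
      · rintro ⟨i, hi⟩
        exact (Fin.castSucc_lt_last i).ne hi
    · rw [Finsupp.mapDomain_apply (Fin.castSucc_injective N)]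
      rfl

instance : Fintype (SPar n m) := Fintype.ofFinite _

end SPar

theorem leadCoeff_eq_zero_of_homog {n m n' m' N : ℕ} (Γ : SPar n m) (h : m ≤ N)
    (hΓ : Γ.length ≤ N) {f : SuperPoly N} (hf : f ∈ homogSuperPoly N n' m')
    (hne : (n, m) ≠ (n', m')) : Γ.leadCoeff h f = 0 := by
  by_contra h'
  obtain ⟨h1, h2⟩ := superCoeff_ne_zero_of_homog hf h'
  rw [degree_exponent Γ hΓ] at h1
  exact hne (by rw [h1, h2])

theorem symSuper_apply_eq_sum {n m : ℕ} {f : SuperFamily} (hf : f ∈ SymSuper n m) (N : ℕ) :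
    f N = ∑ Ω : SPar n m, Ω.familyCoeff f • superMonomialN Ω N := by
  classical
  rw [← sub_eq_zero]
  have hsum : ∑ Ω : SPar n m, Ω.familyCoeff f • superMonomialN Ω N ∈ homogSuperPoly N n m :=
    Submodule.sum_mem _ fun Ω _ => Submodule.smul_mem _ _ (superMonomialN_mem_homog Ω N)
  refine symmSuperPoly_eq_zero (sub_mem (hf.1 N) (sum_mem fun Ω _ =>
    Subalgebra.smul_mem _ (superMonomialN_mem_symm Ω N) _)) fun n' m' Γ h hΓ => ?_
  by_cases hnm : (n', m') = (n, m)
  · obtain ⟨rfl, rfl⟩ := Prod.mk.inj hnm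
    rw [map_sub, map_sum, Γ.leadCoeff_eq_familyCoeff hf hΓ, sub_eq_zero]
    symm
    rw [Finset.sum_eq_single Γ]
    · rw [map_smul, leadCoeff_superMonomialN _ _ hΓ, if_pos rfl, smul_eq_mul, mul_one]
    · intro Ω _ hne
      rw [map_smul, leadCoeff_superMonomialN _ _ hΓ, if_neg hne.symm, smul_zero]
    · exact fun h' => absurd (Finset.mem_univ _) h'
  · rw [map_sub, leadCoeff_eq_zero_of_homog Γ h hΓ (hf.2.1 N) hnm,
      leadCoeff_eq_zero_of_homog Γ h hΓ hsum hnm, sub_zero]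

theorem symSuper_eq_sum {n m : ℕ} {f : SuperFamily} (hf : f ∈ SymSuper n m) :
    f = ∑ Ω : SPar n m, Ω.familyCoeff f • superMonomial Ω := by
  funext N
  rw [Finset.sum_apply, symSuper_apply_eq_sum hf N]
  rfl

theorem familyCoeff_elemSuperRev_conj {n m : ℕ} (Λ : SPar n m) :
    Λ.conj.familyCoeff (elemSuperRev Λ) = 1 :=
  leadCoeff_elemSuperRev_conj Λ _ le_rfl

theorem elemSuperRev_eq_add_sum {n m : ℕ} [DecidableEq (SPar n m)] (Λ : SPar n m) :
    elemSuperRev Λ = superMonomial Λ.conj +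
      ∑ Ω ∈ Finset.univ.erase Λ.conj, Ω.familyCoeff (elemSuperRev Λ) • superMonomial Ω := by
  conv_lhs => rw [symSuper_eq_sum (elemSuperRev_mem Λ)]
  rw [← Finset.add_sum_erase _ _ (Finset.mem_univ Λ.conj), familyCoeff_elemSuperRev_conj, one_smul]

theorem exists_triangular {n m : ℕ} (Λ : SPar n m) : ∃ c : SPar n m →₀ ℤ,
    (∀ Ω ∈ c.support, Ω.BruhatLT Λ.conj) ∧
    elemSuperRev Λ = superMonomial Λ.conj + c.sum fun Ω a => a • superMonomial Ω := by
  classical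
  refine ⟨Finsupp.onFinset (Finset.univ.erase Λ.conj) (fun Ω => if Ω = Λ.conj then 0 else
    Ω.familyCoeff (elemSuperRev Λ)) fun Ω hΩ => ?_, fun Ω hΩ => ?_, ?_⟩
  · refine Finset.mem_erase.2 ⟨fun h => hΩ (if_pos h), Finset.mem_univ _⟩
  · rw [Finsupp.mem_support_iff, Finsupp.onFinset_apply] at hΩ
    have hne : Ω ≠ Λ.conj := fun h => hΩ (if_pos h)
    rw [if_neg hne] at hΩ
    obtain ⟨h1, h2⟩ := le_of_leadCoeff_elemSuperRev_ne_zero _ le_rfl hΩ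
    exact ⟨SPar.bruhatLE_of_le h1 h2, hne⟩
  · rw [Finsupp.onFinset_sum _ fun Ω => zero_smul ℤ (superMonomial Ω)]
    conv_lhs => rw [elemSuperRev_eq_add_sum]
    congr 1
    refine Finset.sum_congr rfl fun Ω hΩ => ?_
    rw [if_neg (Finset.ne_of_mem_erase hΩ)]

/-! ## The elementary basis -/

/-- At an index of the support where `μ` is maximal, the functional sees a single term of the
relation. -/
theorem linearIndependent_of_triangular {R ι M W : Type*} [LinearOrder W] [CommRing R]
    [IsDomain R] [AddCommGroup M] [Module R M] (v : ι → M) (φ : ι → M →ₗ[R] R) (μ : ι → W)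
    (h1 : ∀ i, φ i (v i) ≠ 0) (h2 : ∀ i j, φ i (v j) ≠ 0 → i = j ∨ μ i < μ j) :
    LinearIndependent R v := by
  rw [linearIndependent_iff]
  intro l hl
  by_contra hne
  obtain ⟨i, hi, hmax⟩ := Finset.exists_max_image l.support μ (Finsupp.support_nonempty_iff.2 hne)
  have h3 := congrArg (φ i) hl
  rw [Finsupp.linearCombination_apply, Finsupp.sum, map_sum, map_zero,
    Finset.sum_eq_single_of_mem i hi] at h3
  · rw [map_smul, smul_eq_mul] at h3
    exact (mul_ne_zero (Finsupp.mem_support_iff.1 hi) (h1 i)) h3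
  · intro j hj hji
    rw [map_smul, smul_eq_mul]
    refine mul_eq_zero_of_right _ ?_
    by_contra h4
    rcases h2 i j h4 with h5 | h5
    · exact hji h5.symm
    · exact absurd (hmax j hj) (not_le.2 h5)

/-- Different bidegrees are allowed, at finite `N`, because algebraic independence treats all
bidegrees together; homogeneity separates them. -/
theorem eq_or_rank_lt_of_leadCoeff_elemSuperRev {n m n' m' N : ℕ} (Γ : SPar n m) (Λ : SPar n' m')
    (h : m ≤ N) (hΓ : Γ.conj.length ≤ N) (hne : Γ.conj.leadCoeff h (elemSuperRev Λ N) ≠ 0) :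
    (⟨(n, m), Γ⟩ : (nm : ℕ × ℕ) × SPar nm.1 nm.2) = ⟨(n', m'), Λ⟩ ∨ Γ.conj.rank < Λ.conj.rank := by
  by_cases hnm : (n, m) = (n', m')
  · obtain ⟨rfl, rfl⟩ := Prod.mk.inj hnm
    by_cases hΓΛ : Γ = Λ
    · left; rw [hΓΛ]
    · right
      obtain ⟨h1, h2⟩ := le_of_leadCoeff_elemSuperRev_ne_zero h hΓ hne
      exact SPar.rank_lt_rank h1 h2 fun h' => hΓΛ (SPar.conj_injective h')
  · exact absurd (leadCoeff_eq_zero_of_homog _ h hΓ ((elemSuperRev_mem Λ).2.1 N) hnm) hne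

theorem leadCoeff_elemSuper_ne_zero_iff {n m n' m' N : ℕ} (Γ : SPar n m) (Λ : SPar n' m')
    (h : m ≤ N) :
    Γ.leadCoeff h (elemSuper Λ N) ≠ 0 ↔ Γ.leadCoeff h (elemSuperRev Λ N) ≠ 0 := by
  rcases elemSuperRev_eq_or_add_eq_zero Λ with h1 | h1
  · rw [h1]
  · have h2 : elemSuperRev Λ N + elemSuper Λ N = 0 := congrFun h1 N
    have h3 := congrArg (Γ.leadCoeff h) h2
    rw [map_add, map_zero] at h3
    omega

theorem elemSuperRev_mem_span {n m : ℕ} (Λ : SPar n m) :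
    elemSuperRev Λ ∈ Submodule.span ℤ (Set.range (elemSuper : SPar n m → SuperFamily)) := by
  have hmem : elemSuper Λ ∈ Submodule.span ℤ (Set.range (elemSuper : SPar n m → SuperFamily)) :=
    Submodule.subset_span ⟨Λ, rfl⟩
  rcases elemSuperRev_eq_or_add_eq_zero Λ with h | h
  · rwa [h]
  · refine (Submodule.add_mem_iff_left _ hmem).1 ?_
    rw [h]
    exact zero_mem _

/-- Every `Ω` is a conjugate, and the remaining supermonomials in the expansion of its reversed e_Λ
have smaller rank. -/
theorem superMonomial_mem_span {n m : ℕ} (Ω : SPar n m) :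
    superMonomial Ω ∈ Submodule.span ℤ (Set.range (elemSuper : SPar n m → SuperFamily)) := by
  classical
  induction hr : Ω.rank using WellFoundedLT.induction generalizing Ω with
  | ind r ih =>
    obtain ⟨Λ, rfl⟩ := SPar.conj_bijective.2 Ω
    have h1 := elemSuperRev_mem_span Λ
    rw [elemSuperRev_eq_add_sum] at h1
    refine (Submodule.add_mem_iff_left _ (Submodule.sum_mem _ fun Ω hΩ => ?_)).1 h1
    by_cases hc : Ω.familyCoeff (elemSuperRev Λ) = 0
    · rw [hc, zero_smul]
      exact zero_mem _
    · refine Submodule.smul_mem _ _ (ih _ ?_ Ω rfl)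
      obtain ⟨h2, h3⟩ := le_of_leadCoeff_elemSuperRev_ne_zero _ le_rfl hc
      rw [← hr]
      exact SPar.rank_lt_rank h2 h3 (Finset.ne_of_mem_erase hΩ)

theorem exists_elementary_basis (n m : ℕ) : ∃ b : Module.Basis (SPar n m) ℤ (SymSuper n m),
    ∀ Λ : SPar n m, (b Λ : SuperFamily) = elemSuper Λ := by
  let v : SPar n m → SymSuper n m := fun Λ => ⟨elemSuper Λ, elemSuper_mem Λ⟩
  have hli : LinearIndependent ℤ v := by
    refine linearIndependent_of_triangular v (fun Λ =>
      ((Λ.conj.leadCoeff Λ.conj.le_length).comp (LinearMap.proj Λ.conj.length)).comp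
        (SymSuper n m).subtype) (fun Λ => Λ.conj.rank) (fun Λ => ?_) fun Γ Λ hne => ?_
    · change Λ.conj.leadCoeff _ (elemSuper Λ _) ≠ 0
      rw [leadCoeff_elemSuper_ne_zero_iff, leadCoeff_elemSuperRev_conj Λ _ le_rfl]
      exact one_ne_zero
    · change Γ.conj.leadCoeff _ (elemSuper Λ _) ≠ 0 at hne
      rw [leadCoeff_elemSuper_ne_zero_iff] at hne
      refine (eq_or_rank_lt_of_leadCoeff_elemSuperRev Γ Λ _ le_rfl hne).imp (fun h => ?_) id
      simpa using h
  refine ⟨Module.Basis.mk hli ?_, fun Λ => by rw [Module.Basis.mk_apply]⟩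
  rintro ⟨f, hf⟩ -
  have hspan : f ∈ Submodule.span ℤ (Set.range (elemSuper : SPar n m → SuperFamily)) := by
    rw [symSuper_eq_sum hf]
    exact Submodule.sum_mem _ fun Ω _ => Submodule.smul_mem _ _ (superMonomial_mem_span Ω)
  have hrange : Set.range (elemSuper : SPar n m → SuperFamily) =
      (SymSuper n m).subtype '' Set.range v := by
    rw [← Set.range_comp]; rfl
  rw [hrange, Submodule.span_image] at hspan
  obtain ⟨g, hg, hgf⟩ := hspan
  have : g = ⟨f, hf⟩ := Subtype.ext hgf
  rwa [← this]

end

noncomputable section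

/-! ## Generators of the ring of symmetric superpolynomials -/

theorem exists_degree_bound {N : ℕ} (f : SuperPoly N) :
    ∃ D, ∀ (m : ℕ) (α : Fin N →₀ ℕ) (g : Fin m → Fin N), D < α.degree → superCoeff α g f = 0 := by
  induction f using TensorProduct.induction_on with
  | zero => exact ⟨0, fun _ _ _ _ => map_zero _⟩
  | tmul p w =>
    refine ⟨p.totalDegree, fun m α g h => ?_⟩
    rw [superCoeff_tmul, MvPolynomial.coeff_eq_zero_of_totalDegree_lt, zero_mul]
    rwa [Finsupp.degree_apply] at h
  | add x y hx hy =>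
    obtain ⟨D, hD⟩ := hx
    obtain ⟨D', hD'⟩ := hy
    refine ⟨max D D', fun m α g h => ?_⟩
    rw [map_add, hD _ _ _ (lt_of_le_of_lt (le_max_left _ _) h),
      hD' _ _ _ (lt_of_le_of_lt (le_max_right _ _) h), add_zero]

/-- Superpartitions of arbitrary degree. -/
abbrev AnySPar : Type := (nm : ℕ × ℕ) × SPar nm.1 nm.2

theorem symmSuperPoly_mem_span {N : ℕ} {f : SuperPoly N} (hf : f ∈ SymSuperPoly N) :
    f ∈ Submodule.span ℤ (Set.range fun x : AnySPar => superMonomialN x.2 N) := by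
  classical
  obtain ⟨D, hD⟩ := exists_degree_bound f
  -- `f` need not be homogeneous. Its degree in x is bounded by `D`, and leading terms in `N` pairs
  -- of variables have degree at most `N` in θ.
  let T : Finset AnySPar :=
    (Finset.range (D + 1) ×ˢ Finset.range (N + 1)).sigma fun _ => Finset.univ
  let c : AnySPar → ℤ := fun x => if h : x.1.2 ≤ N then x.2.leadCoeff h f else 0
  have hfc : f = ∑ x ∈ T, c x • superMonomialN x.2 N := by
    rw [← sub_eq_zero]
    refine symmSuperPoly_eq_zero (sub_mem hf (sum_mem fun x _ =>
      Subalgebra.smul_mem _ (superMonomialN_mem_symm x.2 N) _)) fun n m Γ h hΓ => ?_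
    have hδ : ∀ x : AnySPar, Γ.leadCoeff h (superMonomialN x.2 N) =
        if (⟨(n, m), Γ⟩ : AnySPar) = x then 1 else 0 := by
      rintro ⟨⟨n', m'⟩, Ω⟩
      by_cases hnm : (n, m) = (n', m')
      · obtain ⟨rfl, rfl⟩ := Prod.mk.inj hnm
        rw [leadCoeff_superMonomialN _ _ hΓ]
        exact if_congr (by simp) rfl rfl
      · rw [leadCoeff_eq_zero_of_homog Γ h hΓ (superMonomialN_mem_homog Ω N) hnm, if_neg]
        intro h'
        exact hnm (congrArg Sigma.fst h')
    rw [map_sub, map_sum, sub_eq_zero]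
    have hsum : ∑ x ∈ T, Γ.leadCoeff h (c x • superMonomialN x.2 N) =
        ∑ x ∈ T, if (⟨(n, m), Γ⟩ : AnySPar) = x then c x else 0 := by
      refine Finset.sum_congr rfl fun x _ => ?_
      rw [map_smul, hδ, smul_eq_mul, mul_ite, mul_one, mul_zero]
    rw [hsum, Finset.sum_ite_eq]
    split_ifs with hT
    · exact (show c ⟨(n, m), Γ⟩ = _ from dif_pos h).symm
    · refine hD _ _ _ ?_
      rw [degree_exponent Γ hΓ]
      by_contra h'
      refine hT (Finset.mem_sigma.2 ⟨Finset.mem_product.2 ⟨?_, ?_⟩, Finset.mem_univ _⟩)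
      · exact Finset.mem_range.2 (Nat.lt_succ_of_le (not_lt.1 h'))
      · exact Finset.mem_range.2 (Nat.lt_succ_of_le h)
  rw [hfc]
  exact Submodule.sum_mem _ fun x _ => Submodule.smul_mem _ _ (Submodule.subset_span ⟨x, rfl⟩)

/-- The subring generated by `e_1, …, e_N, ẽ_0, …, ẽ_{N-1}`. -/
abbrev elemSubalgebra (N : ℕ) : Subalgebra ℤ (SuperPoly N) :=
  Algebra.adjoin ℤ (Set.range (fun i : Fin N => elemBosonN N (i + 1)) ∪
    Set.range (fun i : Fin N => elemFermionN N i))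

theorem elemBosonN_mem_elemSubalgebra (N k : ℕ) : elemBosonN N k ∈ elemSubalgebra N := by
  rcases Nat.eq_zero_or_pos k with rfl | hk
  · rw [elemBosonN_eq, esymmOn, Finset.powersetCard_zero, Finset.sum_singleton, Finset.prod_empty]
    exact one_mem _
  rcases lt_or_ge N k with hN | hN
  · rw [elemBosonN_eq, esymmOn, Finset.powersetCard_eq_empty.2 (by simpa using hN),
      Finset.sum_empty, TensorProduct.zero_tmul]
    exact zero_mem _
  · refine Algebra.subset_adjoin (Or.inl ⟨⟨k - 1, by omega⟩, ?_⟩)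
    simp only [Nat.sub_add_cancel hk]

theorem elemFermionN_mem_elemSubalgebra (N k : ℕ) : elemFermionN N k ∈ elemSubalgebra N := by
  rcases lt_or_ge k N with hN | hN
  · exact Algebra.subset_adjoin (Or.inr ⟨⟨k, hN⟩, rfl⟩)
  · have : elemFermionN N k = 0 := by
      rw [elemFermionN_eq]
      refine Finset.sum_eq_zero fun i _ => ?_
      rw [esymmOn, Finset.powersetCard_eq_empty.2, Finset.sum_empty, TensorProduct.zero_tmul]
      rw [Finset.card_erase_of_mem (Finset.mem_univ i), Finset.card_univ, Fintype.card_fin]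
      have := i.2
      omega
    rw [this]
    exact zero_mem _

theorem elemSuper_apply_mem_elemSubalgebra {n m : ℕ} (Λ : SPar n m) (N : ℕ) :
    elemSuper Λ N ∈ elemSubalgebra N := by
  rw [elemSuper, Pi.mul_apply, Pi.list_prod_apply, Pi.list_prod_apply]
  refine mul_mem (list_prod_mem fun x hx => ?_) (list_prod_mem fun x hx => ?_)
  · simp only [List.map_map, List.mem_map] at hx
    obtain ⟨k, -, rfl⟩ := hx
    exact elemFermionN_mem_elemSubalgebra N k
  · simp only [List.map_map, List.mem_map] at hx
    obtain ⟨k, -, rfl⟩ := hx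
    exact elemBosonN_mem_elemSubalgebra N k

theorem superMonomialN_mem_elemSubalgebra {n m : ℕ} (Ω : SPar n m) (N : ℕ) :
    superMonomialN Ω N ∈ elemSubalgebra N := by
  have key : ∀ f ∈ Submodule.span ℤ (Set.range (elemSuper : SPar n m → SuperFamily)),
      f N ∈ elemSubalgebra N := by
    intro f hf
    induction hf using Submodule.span_induction with
    | mem x hx => obtain ⟨Λ, rfl⟩ := hx; exact elemSuper_apply_mem_elemSubalgebra Λ N
    | zero => exact zero_mem _
    | add x y _ _ hx hy => exact add_mem hx hy
    | smul a x _ hx => exact Subalgebra.smul_mem _ hx a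
  exact key _ (superMonomial_mem_span Ω)

theorem elemSubalgebra_eq (N : ℕ) : elemSubalgebra N = SymSuperPoly N := by
  refine le_antisymm (Algebra.adjoin_le ?_) fun f hf => ?_
  · rintro _ (⟨i, rfl⟩ | ⟨i, rfl⟩)
    · exact elemBosonN_mem_symm N _
    · exact elemFermionN_mem_symm N _
  · have h := symmSuperPoly_mem_span hf
    clear hf
    induction h using Submodule.span_induction with
    | mem x hx => obtain ⟨y, rfl⟩ := hx; exact superMonomialN_mem_elemSubalgebra y.2 N
    | zero => exact zero_mem _
    | add x y _ _ hx hy => exact add_mem hx hy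
    | smul a x _ hx => exact Subalgebra.smul_mem _ hx a

/-! ## Algebraic independence -/

/-- The length of Λ' is the largest part of Λ, plus one if Λ'ᵃ contains zero. In that case the
largest part belongs to Λᵃ, so it is less than `N`; hence the different index ranges for e and ẽ. -/
theorem SPar.length_conj_le {n m N : ℕ} (Λ : SPar n m) (ha : ∀ b ∈ Λ.anti, b < N)
    (hs : ∀ b ∈ Λ.symm, b ≤ N) : Λ.conj.length ≤ N := by
  have h1 : Λ.sortedEntry 0 ≤ N := by
    by_contra h
    rw [not_le, lt_sortedEntry, numGT, Multiset.card_pos_iff_exists_mem] at h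
    obtain ⟨b, hb⟩ := h
    rw [Multiset.mem_filter, parts, Multiset.mem_add] at hb
    rcases hb with ⟨hb | hb, hN⟩
    · exact absurd (ha b hb) (by omega)
    · exact absurd (hs b hb) (by omega)
  have h2 : (Λ.conj.anti.filter (0 < ·)).card + Λ.conj.symm.card = Λ.sortedEntry 0 := by
    rw [← numGT_conj, numGT, parts, Multiset.filter_add, Multiset.card_add]
    congr 2
    symm
    rw [Multiset.filter_eq_self]
    exact fun b hb => Nat.pos_of_ne_zero fun h0 => Λ.conj.symm_pos (h0 ▸ hb)
  have h3 : (Λ.conj.anti.filter (0 < ·)).card + (Λ.conj.anti.filter fun b => ¬ 0 < b).card = m := by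
    rw [Finset.card_filter_add_card_filter_not, Λ.conj.card_anti]
  have h4 : Λ.conj.anti.filter (fun b => ¬ 0 < b) ⊆ {0} := by
    intro b hb
    rw [Finset.mem_filter] at hb
    rw [Finset.mem_singleton]
    omega
  have h5 := Finset.card_le_card h4
  rw [Finset.card_singleton] at h5
  rw [length]
  by_cases h0 : 0 ∈ Λ.conj.anti
  · obtain ⟨b, hb, hb0⟩ : ∃ b ∈ Λ.anti, Λ.numGT b = 0 := by
      have : 0 ∈ Λ.anti.image Λ.numGT := h0
      simpa using this
    have h6 := Λ.sortedEntry_numGT hb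
    rw [hb0] at h6
    have := ha b hb
    omega
  · have h6 : (Λ.conj.anti.filter fun b => ¬ 0 < b) = ∅ := by
      rw [Finset.filter_eq_empty_iff]
      intro b hb hb'
      exact h0 ((by omega : b = 0) ▸ hb)
    rw [h6, Finset.card_empty] at h3
    omega

/-- The superpartition whose elementary superpolynomial is the image of the monomial
`x^α θ_K`. -/
def monomialSPar {N : ℕ} (α : Fin N →₀ ℕ) (K : Finset (Fin N)) :
    SPar ((K.map Fin.valEmbedding).val.sum +
      ((Finsupp.toMultiset α).map fun i : Fin N => (i : ℕ) + 1).sum) K.card where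
  anti := K.map Fin.valEmbedding
  symm := (Finsupp.toMultiset α).map fun i : Fin N => (i : ℕ) + 1
  card_anti := Finset.card_map _
  symm_pos := by simp
  sum_eq := rfl

theorem monomialSPar_injective {N : ℕ} : Function.Injective
    fun i : (Fin N →₀ ℕ) × Finset (Fin N) => (⟨(_, _), monomialSPar i.1 i.2⟩ : AnySPar) := by
  rintro ⟨α, K⟩ ⟨β, L⟩ h
  have h1 : (monomialSPar α K).anti = (monomialSPar β L).anti :=
    congrArg (fun x : AnySPar => x.2.anti) h
  have h2 : (monomialSPar α K).symm = (monomialSPar β L).symm :=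
    congrArg (fun x : AnySPar => x.2.symm) h
  have h3 : Function.Injective fun i : Fin N => (i : ℕ) + 1 := fun a b hab =>
    Fin.ext (Nat.succ_injective hab)
  exact Prod.ext (Function.LeftInverse.injective Finsupp.toMultiset_toFinsupp (Multiset.map_injective h3 h2))
    (Finset.map_injective _ h1)

theorem length_conj_monomialSPar_le {N : ℕ} (α : Fin N →₀ ℕ) (K : Finset (Fin N)) :
    (monomialSPar α K).conj.length ≤ N := by
  refine SPar.length_conj_le _ (fun b hb => ?_) fun b hb => ?_
  · obtain ⟨i, -, rfl⟩ := Finset.mem_map.1 hb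
    exact i.2
  · obtain ⟨i, -, rfl⟩ := Multiset.mem_map.1 hb
    exact i.2

/-- The conjugates have length at most `N`, so their leading coefficients are still visible in `N`
pairs of variables. -/
theorem linearIndependent_elemSuperRev (N : ℕ) : LinearIndependent ℤ
    fun i : (Fin N →₀ ℕ) × Finset (Fin N) => elemSuperRev (monomialSPar i.1 i.2) N := by
  have hK : ∀ K : Finset (Fin N), K.card ≤ N := fun K => by simpa using Finset.card_le_univ K
  refine linearIndependent_of_triangular _
    (fun i => (monomialSPar i.1 i.2).conj.leadCoeff (hK i.2))
    (fun i => (monomialSPar i.1 i.2).conj.rank) (fun i => ?_) fun i j hne => ?_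
  · rw [leadCoeff_elemSuperRev_conj _ _ (length_conj_monomialSPar_le _ _)]
    exact one_ne_zero
  · exact (eq_or_rank_lt_of_leadCoeff_elemSuperRev _ _ _ (length_conj_monomialSPar_le _ _)
      hne).imp (fun h => monomialSPar_injective h) id

theorem sum_mul_self_eq_zero {R ι : Type*} [Ring R] (s : Finset ι) (f : ι → R)
    (h1 : ∀ i, f i * f i = 0) (h2 : ∀ i j, f i * f j + f j * f i = 0) :
    (∑ i ∈ s, f i) * ∑ i ∈ s, f i = 0 := by
  classical
  induction s using Finset.induction_on with
  | empty => simp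
  | insert a s ha ih =>
    rw [Finset.sum_insert ha, mul_add, add_mul, add_mul, h1, ih, zero_add, add_zero,
      Finset.sum_mul, Finset.mul_sum, ← Finset.sum_add_distrib]
    exact Finset.sum_eq_zero fun i _ => h2 _ _

theorem elemFermionN_sq (N k : ℕ) : elemFermionN N k * elemFermionN N k = 0 := by
  rw [elemFermionN_eq]
  refine sum_mul_self_eq_zero _ _ (fun i => ?_) fun i j => tmul_ι_anticomm _ _ _ _
  rw [Algebra.TensorProduct.tmul_mul_tmul, ExteriorAlgebra.ι_sq_zero, TensorProduct.tmul_zero]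

theorem commute_tmul_one {N : ℕ} (q : MvPolynomial (Fin N) ℤ) (z : SuperPoly N) :
    Commute (q ⊗ₜ[ℤ] (1 : ExteriorAlgebra ℤ (Fin N → ℤ))) z := by
  induction z using TensorProduct.induction_on with
  | zero => exact Commute.zero_right _
  | tmul q' u =>
    rw [Commute, SemiconjBy, Algebra.TensorProduct.tmul_mul_tmul,
      Algebra.TensorProduct.tmul_mul_tmul, mul_comm q, one_mul, mul_one]
  | add x y hx hy => exact hx.add_right hy

/-- The ring homomorphism `x_i ↦ e_{i+1}`. -/
def elemHomLeft (N : ℕ) : MvPolynomial (Fin N) ℤ →ₐ[ℤ] SuperPoly N :=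
  Algebra.TensorProduct.includeLeft.comp
    (MvPolynomial.aeval fun i : Fin N => esymmOn (Finset.univ : Finset (Fin N)) (i + 1))

/-- The ring homomorphism `θ_i ↦ ẽ_i`. -/
def elemHomRight (N : ℕ) : ExteriorAlgebra ℤ (Fin N → ℤ) →ₐ[ℤ] SuperPoly N :=
  ExteriorAlgebra.lift ℤ ⟨Fintype.linearCombination ℤ fun i : Fin N => elemFermionN N i,
    fun v => by
      rw [Fintype.linearCombination_apply]
      refine sum_mul_self_eq_zero _ _ (fun i => ?_) fun i j => ?_
      · rw [smul_mul_smul_comm, elemFermionN_sq, smul_zero]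
      · have := congrFun (elemFermion_anticomm i j) N
        rw [smul_mul_smul_comm, smul_mul_smul_comm, mul_comm (v j), ← smul_add]
        exact (congrArg _ this).trans (smul_zero _)⟩

theorem elemHomLeft_apply {N : ℕ} (p : MvPolynomial (Fin N) ℤ) : elemHomLeft N p =
    (MvPolynomial.aeval (fun i : Fin N => esymmOn (Finset.univ : Finset (Fin N)) (i + 1)) p)
      ⊗ₜ 1 := rfl

theorem elemHomRight_ι {N : ℕ} (i : Fin N) :
    elemHomRight N (ExteriorAlgebra.ι ℤ (Pi.single i (1 : ℤ))) = elemFermionN N i := by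
  rw [elemHomRight, ExteriorAlgebra.lift_ι_apply, Fintype.linearCombination_apply_single, one_smul]

/-- The ring homomorphism `x_i ↦ e_{i+1}`, `θ_i ↦ ẽ_i`. -/
def elemHom (N : ℕ) : SuperPoly N →ₐ[ℤ] SuperPoly N :=
  Algebra.TensorProduct.lift (elemHomLeft N) (elemHomRight N) fun _ _ => commute_tmul_one _ _

theorem elemHom_tmul {N : ℕ} (p : MvPolynomial (Fin N) ℤ) (w : ExteriorAlgebra ℤ (Fin N → ℤ)) :
    elemHom N (p ⊗ₜ w) = elemHomLeft N p * elemHomRight N w :=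
  Algebra.TensorProduct.lift_tmul (elemHomLeft N) (elemHomRight N)
    (fun _ _ => commute_tmul_one _ _) p w

/-- The basis lists the θ's by increasing index, so the ẽ's appear in increasing order: this is the
reversed e_Λ, with no sign to track. -/
theorem elemHom_superBasis {N : ℕ} (α : Fin N →₀ ℕ) (K : Finset (Fin N)) :
    elemHom N (superBasis N (α, K)) = elemSuperRev (monomialSPar α K) N := by
  have hF : elemHomRight N (thetaMul (K.orderEmbOfFin rfl)) =
      ((monomialSPar α K).antiList.reverse.map elemFermion).prod N := by
    have h1 : ((monomialSPar α K).anti.orderEmbOfFin (monomialSPar α K).card_anti : _ → ℕ) =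
        fun k => ((K.orderEmbOfFin rfl k : Fin N) : ℕ) := by
      symm
      refine Finset.orderEmbOfFin_unique _ (fun k => ?_) fun a b hab => ?_
      · exact Finset.mem_map.2 ⟨_, Finset.orderEmbOfFin_mem K rfl k, rfl⟩
      · exact (K.orderEmbOfFin rfl).strictMono hab
    rw [Pi.list_prod_apply, List.map_map, SPar.reverse_antiList, List.map_ofFn, h1, thetaMul,
      ExteriorAlgebra.ιMulti_apply, map_list_prod, List.map_ofFn]
    congr 2
    funext k
    exact elemHomRight_ι _
  have hB : elemHomLeft N (MvPolynomial.monomial α 1) =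
      ((monomialSPar α K).symmList.map elemBoson).prod N := by
    have h1 : ∀ l : List ℕ, (l.map elemBoson).prod N =
        ((l.map fun b => esymmOn (Finset.univ : Finset (Fin N)) b).prod) ⊗ₜ[ℤ] 1 := by
      intro l
      induction l with
      | nil => rfl
      | cons a l ih =>
        rw [List.map_cons, List.prod_cons, Pi.mul_apply, ih, List.map_cons, List.prod_cons]
        change (esymmOn Finset.univ a ⊗ₜ[ℤ] 1) * _ = _
        rw [Algebra.TensorProduct.tmul_mul_tmul, mul_one]
    have h2 : ∀ s : Multiset (Fin N),
        (s.map fun i : Fin N => esymmOn (Finset.univ : Finset (Fin N)) ((i : ℕ) + 1)).prod =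
        (Multiset.toFinsupp s).prod fun i a =>
          esymmOn (Finset.univ : Finset (Fin N)) ((i : ℕ) + 1) ^ a := by
      intro s
      rw [Finset.prod_multiset_map_count]
      rfl
    rw [elemHomLeft_apply, h1, ← Multiset.prod_coe, ← Multiset.map_coe, SPar.coe_symmList,
      MvPolynomial.aeval_monomial, map_one, one_mul]
    change _ = (Multiset.map _ (Multiset.map _ _)).prod ⊗ₜ _
    rw [Multiset.map_map]
    have h3 := h2 (Finsupp.toMultiset α)
    rw [Finsupp.toMultiset_toFinsupp] at h3
    rw [← h3]
    rfl
  rw [superBasis_apply, elemHom_tmul, hF, hB, elemSuperRev, Pi.mul_apply, ← hB, elemHomLeft_apply,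
    (commute_tmul_one _ _).eq]

theorem elemHom_injective (N : ℕ) : Function.Injective (elemHom N) := by
  rw [injective_iff_map_eq_zero]
  intro f hf
  have h1 := linearIndependent_elemSuperRev N
  rw [linearIndependent_iff] at h1
  have h2 : Finsupp.linearCombination ℤ
      (fun i : (Fin N →₀ ℕ) × Finset (Fin N) => elemSuperRev (monomialSPar i.1 i.2) N)
      ((superBasis N).repr f) = 0 := by
    have h3 := (superBasis N).linearCombination_repr f
    rw [← h3, Finsupp.linearCombination_apply, Finsupp.sum, map_sum] at hf
    rw [Finsupp.linearCombination_apply, Finsupp.sum, ← hf]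
    refine Finset.sum_congr rfl fun i _ => ?_
    rw [map_zsmul, elemHom_superBasis]
  exact (superBasis N).repr.map_eq_zero_iff.1 (h1 _ h2)

end

theorem mainTheorem8 :
    -- triangularity of the reversed elementary superfunctions
    (∀ (n m : ℕ) (Λ : SPar n m), ∃ c : SPar n m →₀ ℤ,
      (∀ Ω ∈ c.support, Ω.BruhatLT Λ.conj) ∧
      elemSuperRev Λ = superMonomial Λ.conj + c.sum fun Ω a => a • superMonomial Ω) ∧
    -- the elementary superfunctions form an integral basis
    (∀ n m : ℕ, ∃ b : Module.Basis (SPar n m) ℤ (SymSuper n m),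
      ∀ Λ : SPar n m, (b Λ : SuperFamily) = elemSuper Λ) ∧
    -- fundamental theorem: generation and algebraic independence in `N` pairs of variables
    (∀ N : ℕ,
      Algebra.adjoin ℤ
        (Set.range (fun i : Fin N => elemBosonN N (i + 1)) ∪
          Set.range (fun i : Fin N => elemFermionN N i)) = SymSuperPoly N ∧
      ∃ Φ : SuperPoly N →ₐ[ℤ] SuperPoly N,
        (∀ i : Fin N, Φ (xVar i) = elemBosonN N (i + 1)) ∧
        (∀ i : Fin N, Φ (thetaVar i) = elemFermionN N i) ∧
        Function.Injective Φ) := by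
  refine ⟨fun n m Λ => exists_triangular Λ, exists_elementary_basis, fun N =>
    ⟨elemSubalgebra_eq N, elemHom N, fun i => ?_, fun i => ?_, elemHom_injective N⟩⟩
  · rw [xVar, elemHom_tmul, map_one, mul_one, elemHomLeft_apply, MvPolynomial.aeval_X,
      elemBosonN_eq]
  · rw [thetaVar, elemHom_tmul, map_one, one_mul, elemHomRight_ι]
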